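/- Let $f:[0,\infty)\to\mathbb{R}$ be a regular standard monotone function: $f$ is operator monotone ($0\le A\le B$ implies $f(A)\le f(B)$), $f(x)=x f(1/x)$ for $x>0$, $f(1)=1$, and $f(0)=\lim_{x\to 0^+}f(x)\neq 0$. For a density operator $\rho=\sum_i\lambda_i|i\rangle\langle i|$ and a self-adjoint operator $H$, both on a complex Hilbert space, let $$I^f(\rho,H)=\frac{f(0)}{2}\sum_{i,j}\frac{(\lambda_i-\lambda_j)^2}{\lambda_j f(\lambda_i/\lambda_j)}\,|\langle i|H|j\rangle|^2\in[0,\infty]$$ be the metric adjusted skew information, where $\lambda_j f(\lambda_i/\lambda_j)$ is read as $\lambda_i f(0)$ if $\lambda_j=0$, terms with $\lambda_i=\lambda_j$ are $0$, and the value is $\infty$ if some eigenvector of $\rho$ with nonzero eigenvalue is not in the domain of $H$. Let $H$ be a (possibly unbounded) self-adjoint operator on a complex Hilbert space and let $\psi$ be a pure state of period $2\pi$, that is, $\inf\{t>0:|\langle\psi|e^{-\mathrm{i}tH}|\psi\rangle|=1\}=2\pi$, with finite absolute third moment $\langle\psi||H|^3|\psi\rangle<\infty$. Let $R>0$ and $H_{\mathrm{iid},k}=\sum_{i=1}^k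 \mathbb{I}^{\otimes i-1}\otimes H\otimes\mathbb{I}^{\otimes k-i}$ (as a self-adjoint operator, i.e. the closure of the algebraic sum). Let $D(\rho,\sigma)=\frac12\|\rho-\sigma\|_1$ be the trace distance. Then there is a real function $\delta^f$ with $\lim_{\epsilon\to0^+}\delta^f(\epsilon)=0$ such that for every sufficiently small $\epsilon>0$ and every sequence of states $\rho_m$ with $D(\rho_m,\psi^{\otimes\lceil Rm\rceil})\le\epsilon$ for all sufficiently large $m$, $$I^f\left(\rho_m,H_{\mathrm{iid},\lceil Rm\rceil}\right)\ \ge\ I^f\left(\psi^{\otimes\lceil Rm\rceil},H_{\mathrm{iid},\lceil Rm\rceil}\right)-m\,\delta^f(\epsilon)+o(m)\qquad(m\to\infty).$$ The function $\delta^f$ does not depend on the sequence $(\rho_m)_m$. -/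

import Mathlib

open Filter Topology MeasureTheory
open scoped ENNReal InnerProductSpace

noncomputable section

/-! ### Standard monotone functions -/

open scoped ComplexOrder in
/-- A regular standard monotone function: operator monotone on `[0, ∞)`, symmetric, normalized, and
with `f 0 ≠ 0`, where `f 0` is the limit of `f` at `0` from the right. -/
structure IsRegularStandardMonotone (f : ℝ → ℝ) : Prop where
  operator_monotone : ∀ (n : ℕ) (A B : Matrix (Fin n) (Fin n) ℂ), A.PosSemidef →
    (B - A).PosSemidef → (cfc f B - cfc f A).PosSemidef
  symm : ∀ x : ℝ, 0 < x → f x = x * f (1 / x)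
  one : f 1 = 1
  tendsto_zero : Tendsto f (𝓝[>] 0) (𝓝 (f 0))
  regular : f 0 ≠ 0

/-- The Morozova–Chentsov function `c_f(x, y) = 1 / (y f(x / y))` for `x, y > 0`, extended to
`y = 0` by its limit `c_f(x, 0) = 1 / (x f(0))`. -/
def morozovaChentsov (f : ℝ → ℝ) (x y : ℝ) : ℝ :=
  if y = 0 then 1 / (x * f 0) else 1 / (y * f (x / y))

section HilbertSpace

variable {E : Type*} [NormedAddCommGroup E] [InnerProductSpace ℂ E] [CompleteSpace E]

/-! ### States and the trace distance -/

/-- The trace `∑ᵢ ⟨eᵢ, T eᵢ⟩ ∈ [0, ∞]` of a positive operator `T`, in an orthonormal basis of `E`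
(for positive `T` the value does not depend on the basis). -/
def posTrace (T : E →L[ℂ] E) : ℝ≥0∞ :=
  ∑' e : (exists_hilbertBasis ℂ E).choose, ENNReal.ofReal (RCLike.re ⟪(e : E), T (e : E)⟫_ℂ)

/-- Density operators: positive operators of unit trace. -/
def IsDensityOperator (ρ : E →L[ℂ] E) : Prop :=
  ρ.IsPositive ∧ posTrace ρ = 1

/-- The operator `|φ⟩⟨φ|`. -/
def pureState (φ : E) : E →L[ℂ] E :=
  InnerProductSpace.rankOne ℂ φ φ

/-- The trace distance `D(ρ, σ) = ‖ρ - σ‖₁ / 2`, where `‖T‖₁ = Tr |T|`. -/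
def traceDist (ρ σ : E →L[ℂ] E) : ℝ≥0∞ :=
  posTrace (CFC.abs (ρ - σ)) / 2

/-! ### Metric adjusted skew information -/

open Classical in
/-- `|⟨u|H|v⟩|²` for a symmetric operator `H`, provided that `u` or `v` lies in its domain
(it is only used in that case). -/
def matrixElementSq (H : E →ₗ.[ℂ] E) (u v : E) : ℝ≥0∞ :=
  if hv : v ∈ H.domain then ‖⟪u, H ⟨v, hv⟩⟫_ℂ‖ₑ ^ 2
  else if hu : u ∈ H.domain then ‖⟪H ⟨u, hu⟩, v⟫_ℂ‖ₑ ^ 2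
  else 0

/-- `f(0)/2 ∑ᵢⱼ (λᵢ - λⱼ)² c_f(λᵢ, λⱼ) |⟨i|H|j⟩|²` for an orthonormal basis `e` with eigenvalues
`lam`. -/
def skewSum (f : ℝ → ℝ) (H : E →ₗ.[ℂ] E) {w : Set E} (e : HilbertBasis w ℂ E) (lam : w → ℝ) :
    ℝ≥0∞ :=
  ∑' (i : w) (j : w),
    ENNReal.ofReal (f 0 / 2 * ((lam i - lam j) ^ 2 * morozovaChentsov f (lam i) (lam j))) *
      matrixElementSq H (e i) (e j)

/-- The metric adjusted skew information `I^f(ρ, H) ∈ [0, ∞]` of a state `ρ`, through an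
orthonormal eigenbasis of `ρ`. Its value does not depend on the eigenbasis (the infimum runs over
equal values), and it is `∞` if some eigenvector of `ρ` with nonzero eigenvalue lies outside of the
domain of `H`. -/
def skewInformation (f : ℝ → ℝ) (ρ : E →L[ℂ] E) (H : E →ₗ.[ℂ] E) : ℝ≥0∞ :=
  ⨅ (w : Set E) (e : HilbertBasis w ℂ E) (lam : w → ℝ)
    (_ : ∀ i, ρ (e i) = (lam i : ℂ) • e i)
    (_ : ∀ i, lam i ≠ 0 → e i ∈ H.domain), skewSum f H e lam

/-! ### Time evolution, period and energy distribution -/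

/-- `U` is the one-parameter group `t ↦ e^{-itH}`: a strongly continuous unitary group such that
`H` is the operator `x ↦ i d/dt|₀ U t x`, with its full domain. -/
structure IsTimeEvolution (H : E →ₗ.[ℂ] E) (U : ℝ → E →L[ℂ] E) : Prop where
  zero : U 0 = 1
  add : ∀ s t, U (s + t) = U s * U t
  unitary : ∀ t, U t ∈ unitary (E →L[ℂ] E)
  continuous : ∀ x, Continuous fun t => U t x
  generator : ∀ x y, (x, y) ∈ H.graph ↔ HasDerivAt (fun t => U t x) (-Complex.I • y) 0

open Classical in
/-- The unitary group `t ↦ e^{-itH}` of a self-adjoint operator `H`, which exists and is unique by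
Stone's theorem. -/
def timeEvolution (H : E →ₗ.[ℂ] E) : ℝ → E →L[ℂ] E :=
  if h : ∃ U, IsTimeEvolution H U then h.choose else 0

/-- The period `inf {t > 0 : |⟨φ|e^{-itH}|φ⟩| = 1}` of a pure state. As a real infimum it is `0`
if there is no such `t`, so that a positive value means that the period is finite and positive. -/
def period (H : E →ₗ.[ℂ] E) (φ : E) : ℝ :=
  sInf {t : ℝ | 0 < t ∧ ‖⟪φ, timeEvolution H t φ⟫_ℂ‖ = 1}

/-- `μ` is the energy distribution (spectral measure) of `φ` with respect to `H`: the finite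
measure on `ℝ` with `⟨φ|e^{-itH}|φ⟩ = ∫ e^{-itx} dμ(x)` for all `t`. It is unique. -/
def IsEnergyDistribution (H : E →ₗ.[ℂ] E) (φ : E) (μ : Measure ℝ) : Prop :=
  IsFiniteMeasure μ ∧
    ∀ t : ℝ, ⟪φ, timeEvolution H t φ⟫_ℂ = ∫ x : ℝ, Complex.exp (-Complex.I * t * x) ∂μ

/-- The absolute moment `⟨φ| |H|^p |φ⟩ ∈ [0, ∞]`, the integral of `|x|^p` with respect to the
energy distribution of `φ` (the infimum runs over exactly one measure). -/
def absMoment (p : ℕ) (H : E →ₗ.[ℂ] E) (φ : E) : ℝ≥0∞ :=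
  ⨅ (μ : Measure ℝ) (_ : IsEnergyDistribution H φ μ), ∫⁻ x : ℝ, ‖x‖ₑ ^ p ∂μ

end HilbertSpace

/-! ### Tensor powers -/

/-- The `k`-th Hilbert space tensor power of a Hilbert space with an orthonormal basis indexed by
`ι`: the Hilbert space with orthonormal basis indexed by `ι^k`. -/
abbrev HilbertTensorPower (ι : Type*) (k : ℕ) : Type _ :=
  lp (fun _ : Fin k → ι => ℂ) 2

section TensorPower

variable {K : Type*} [NormedAddCommGroup K] [InnerProductSpace ℂ K] {ι : Type*}

theorem summable_prod_pi {k : ℕ} (g : Fin k → ι → ℝ) (h0 : ∀ i a, 0 ≤ g i a)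
    (hg : ∀ i, Summable (g i)) : Summable fun a : Fin k → ι => ∏ i, g i (a i) := by
  classical
  have hpos : ∀ a : Fin k → ι, 0 ≤ ∏ i, g i (a i) := fun a =>
    Finset.prod_nonneg fun i _ => h0 i _
  refine summable_of_sum_le (c := ∏ i, ∑' x, g i x) hpos fun s => ?_
  have hs : s ⊆ Fintype.piFinset fun i => s.image fun a => a i := fun a ha =>
    Fintype.mem_piFinset.2 fun i => Finset.mem_image_of_mem (fun a => a i) ha
  refine (Finset.sum_le_sum_of_subset_of_nonneg hs fun a _ _ => hpos a).trans ?_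
  rw [← Finset.prod_univ_sum (fun i => s.image fun a => a i) g]
  exact Finset.prod_le_prod (fun i _ => Finset.sum_nonneg fun x _ => h0 i x)
    fun i _ => (hg i).sum_le_tsum _ fun x _ => h0 i x

theorem memℓp_productVector (b : HilbertBasis ι ℂ K) {k : ℕ} (x : Fin k → K) :
    Memℓp (fun a : Fin k → ι => ∏ i, b.repr (x i) (a i)) 2 := by
  refine memℓp_gen ?_
  have h := summable_prod_pi (fun i a => ‖b.repr (x i) a‖ ^ (2 : ℝ≥0∞).toReal)
    (fun i a => by positivity) fun i => (lp.memℓp (b.repr (x i))).summable (by norm_num)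
  refine h.congr fun a => ?_
  rw [norm_prod, Real.finsetProd_rpow _ _ fun i _ => norm_nonneg _]

/-- The product vector `x₁ ⊗ ⋯ ⊗ x_k`: its coordinates in the product basis are the products of the
coordinates of the factors. -/
def productVector (b : HilbertBasis ι ℂ K) {k : ℕ} (x : Fin k → K) : HilbertTensorPower ι k :=
  ⟨fun a => ∏ i, b.repr (x i) (a i), memℓp_productVector b x⟩

/-- The Hamiltonian `∑ᵢ 1^{⊗(i-1)} ⊗ H ⊗ 1^{⊗(k-i)}` on the `k`-th tensor power: the closure of the
operator that maps `x₁ ⊗ ⋯ ⊗ x_k`, with all factors in the domain of `H`, to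
`∑ᵢ x₁ ⊗ ⋯ ⊗ H xᵢ ⊗ ⋯ ⊗ x_k`. It is defined through its graph. -/
def iidHamiltonian (b : HilbertBasis ι ℂ K) (H : K →ₗ.[ℂ] K) (k : ℕ) :
    HilbertTensorPower ι k →ₗ.[ℂ] HilbertTensorPower ι k :=
  (Submodule.span ℂ {p : HilbertTensorPower ι k × HilbertTensorPower ι k |
    ∃ x : Fin k → H.domain, p = (productVector b fun j => (x j : K),
      ∑ i, productVector b (Function.update (fun j => (x j : K)) i (H (x i))))}
    ).topologicalClosure.toLinearPMap

/-- The vector `φ^{⊗k}`. -/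
def iidVector (b : HilbertBasis ι ℂ K) (φ : K) (k : ℕ) : HilbertTensorPower ι k :=
  productVector b fun _ => φ

end TensorPower

end

/-! On a pure state the skew information is at most the variance of the Hamiltonian, so at `ψ^{⊗k}`
it is at most `k Var_ψ(H)`. It remains to bound it from below near `Ψ = ψ^{⊗k}`, with constants that
do not depend on `k`.

A state `ρ` within trace distance `ε` of `Ψ` has one eigenvalue near 1, with eigenvector `φ` near
`Ψ`, and all others are `O(ε)` (`exists_top_eigenvector`). The terms of the skew sum that involve
`φ` carry weights that tend to those of a pure state, because `f` is continuous at 0 with `f 0 > 0`.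
Hence `I^f(ρ, H_k) ≥ κ Var_φ(H_k)` with `κ → 1` (`le_skewInformation`).

The core is that the variance cannot drop much near a product state: `Var_φ(H_k) ≥ k (Var_ψ(H) - τ)`
once `|⟨Ψ, φ⟩|² ≥ 1 - s`, with `s` independent of `k` (`variance_iidHamiltonian_lower_bound`). This
is a duality argument. Let `h = (H - E)ψ` with `E` the mean energy, let `η ⟂ ψ` in the domain be
close to `h`, and let `χ` be the sum over all places of `η` put into `Ψ`. Then `‖χ‖ = √k ‖η‖` and
`⟨χ, (H_k - kE)Ψ⟩ = k ⟨η, h⟩`, while `(H_k - kE)χ` has norm only `O(k)`. Pairing `χ` with the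
centred vector `H_k φ` therefore gives about `k ⟨η, h⟩`, up to `O(k √s)`, and Cauchy–Schwarz bounds
the standard deviation in `φ` from below.

The period and moment hypotheses enter through `ψ ∈ H.domain`. -/

/-! ### Product vectors -/

section ProductVector

variable {K : Type*} [NormedAddCommGroup K] [InnerProductSpace ℂ K] {ι : Type*}

theorem productVector_apply (b : HilbertBasis ι ℂ K) {k : ℕ} (x : Fin k → K) (a : Fin k → ι) :
    productVector b x a = ∏ i, b.repr (x i) (a i) := rfl

theorem tsum_prod_pi {k : ℕ} (g : Fin k → ι → ℂ)
    (hg : ∀ i, Summable (g i)) : ∑' a : Fin k → ι, ∏ i, g i (a i) = ∏ i, ∑' x, g i x := by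
  classical
  have hs : Summable fun a : Fin k → ι => ∏ i, g i (a i) := by
    refine Summable.of_norm ?_
    simp_rw [norm_prod]
    exact summable_prod_pi (fun i x => ‖g i x‖) (fun _ _ => norm_nonneg _) fun i => (hg i).norm
  -- Boxes `s^k` are cofinal among the finite index sets, and over a box the sum factorizes.
  have h1 : Tendsto (fun s : Finset ι => Fintype.piFinset fun _ : Fin k => s) atTop atTop := by
    refine tendsto_atTop.2 fun t => ?_
    filter_upwards [eventually_ge_atTop (t.biUnion fun a => Finset.univ.image a)] with s hst
    intro a ha
    refine Fintype.mem_piFinset.2 fun i => hst ?_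
    exact Finset.mem_biUnion.2 ⟨a, ha, Finset.mem_image_of_mem _ (Finset.mem_univ i)⟩
  have h2 := hs.hasSum.comp h1
  have h3 : Tendsto (fun s : Finset ι => ∏ i, ∑ x ∈ s, g i x) atTop (𝓝 (∏ i, ∑' x, g i x)) :=
    tendsto_finsetProd _ fun i _ => (hg i).hasSum
  refine tendsto_nhds_unique h2 (h3.congr fun s => ?_)
  exact Finset.prod_univ_sum (fun _ => s) g

theorem inner_productVector (b : HilbertBasis ι ℂ K) {k : ℕ} (x y : Fin k → K) :
    ⟪productVector b x, productVector b y⟫_ℂ = ∏ i, ⟪x i, y i⟫_ℂ := by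
  rw [lp.inner_eq_tsum]
  have h : ∀ i, ⟪x i, y i⟫_ℂ = ∑' a, ⟪b.repr (x i) a, b.repr (y i) a⟫_ℂ := fun i => by
    rw [← lp.inner_eq_tsum, LinearIsometryEquiv.inner_map_map]
  simp_rw [h]
  rw [← tsum_prod_pi _ fun i => lp.summable_inner _ _]
  refine tsum_congr fun a => ?_
  simp [productVector_apply, Finset.prod_mul_distrib]

theorem norm_productVector (b : HilbertBasis ι ℂ K) {k : ℕ} (x : Fin k → K) :
    ‖productVector b x‖ = ∏ i, ‖x i‖ := by
  have h := inner_productVector b x x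
  simp_rw [inner_self_eq_norm_sq_to_K] at h
  have h2 : ‖productVector b x‖ ^ 2 = (∏ i, ‖x i‖) ^ 2 := by
    rw [← Finset.prod_pow]
    exact_mod_cast h
  exact (pow_left_inj₀ (norm_nonneg _) (Finset.prod_nonneg fun _ _ => norm_nonneg _)
    two_ne_zero).1 h2

/-- The continuous multilinear map `(x₁, …, x_k) ↦ x₁ ⊗ ⋯ ⊗ x_k`. -/
noncomputable def productVectorCLM (b : HilbertBasis ι ℂ K) (k : ℕ) :
    ContinuousMultilinearMap ℂ (fun _ : Fin k => K) (HilbertTensorPower ι k) :=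
  MultilinearMap.mkContinuous
    { toFun := productVector b
      map_update_add' := fun {inst} m i x y => by
        obtain rfl : inst = instDecidableEqFin k := Subsingleton.elim _ _
        ext a
        rw [lp.coeFn_add, Pi.add_apply]
        simp only [productVector_apply]
        have h : ∀ z : K, ∏ j, b.repr (Function.update m i z j) (a j)
            = b.repr z (a i) * ∏ j ∈ Finset.univ.erase i, b.repr (m j) (a j) := fun z => by
          rw [← Finset.mul_prod_erase _ _ (Finset.mem_univ i), Function.update_self]
          congr 1
          refine Finset.prod_congr rfl fun j hj => ?_
          rw [Function.update_of_ne (Finset.ne_of_mem_erase hj)]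
        rw [h, h, h, map_add, lp.coeFn_add, Pi.add_apply, add_mul]
      map_update_smul' := fun {inst} m i c x => by
        obtain rfl : inst = instDecidableEqFin k := Subsingleton.elim _ _
        ext a
        rw [lp.coeFn_smul, Pi.smul_apply]
        simp only [productVector_apply]
        have h : ∀ z : K, ∏ j, b.repr (Function.update m i z j) (a j)
            = b.repr z (a i) * ∏ j ∈ Finset.univ.erase i, b.repr (m j) (a j) := fun z => by
          rw [← Finset.mul_prod_erase _ _ (Finset.mem_univ i), Function.update_self]
          congr 1
          refine Finset.prod_congr rfl fun j hj => ?_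
          rw [Function.update_of_ne (Finset.ne_of_mem_erase hj)]
        rw [h, h, map_smul, lp.coeFn_smul, Pi.smul_apply, smul_mul_assoc] }
    1 fun m => by
      rw [one_mul]
      exact (norm_productVector b m).le

theorem productVectorCLM_apply (b : HilbertBasis ι ℂ K) {k : ℕ} (x : Fin k → K) :
    productVectorCLM b k x = productVector b x := rfl

theorem productVector_update_sub_smul (b : HilbertBasis ι ℂ K) {k : ℕ} (x : Fin k → K) (i : Fin k)
    (y z : K) (c : ℂ) :
    productVector b (Function.update x i (y - c • z)) =
      productVector b (Function.update x i y) - c • productVector b (Function.update x i z) := by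
  simp only [← productVectorCLM_apply, ContinuousMultilinearMap.map_update_sub,
    ContinuousMultilinearMap.map_update_smul]

/-- By continuity, a vector orthogonal to these products is orthogonal to all product vectors, among
them the product basis. -/
theorem dense_span_productVector (b : HilbertBasis ι ℂ K) (k : ℕ) {s : Set K} (hs : Dense s) :
    Dense (Submodule.span ℂ
      {v | ∃ x : Fin k → K, (∀ i, x i ∈ s) ∧ v = productVector b x} :
        Set (HilbertTensorPower ι k)) := by
  classical
  rw [Submodule.dense_iff_topologicalClosure_eq_top, Submodule.topologicalClosure_eq_top_iff,
    Submodule.eq_bot_iff]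
  intro y hy
  have hd : Dense {x : Fin k → K | ∀ i, x i ∈ s} := by
    have := dense_pi (Set.univ : Set (Fin k)) (s := fun _ => s) fun _ _ => hs
    simpa [Set.pi] using this
  have hcont : Continuous fun x : Fin k → K => ⟪productVector b x, y⟫_ℂ := by
    have : Continuous (productVector b (k := k)) := (productVectorCLM b k).cont
    fun_prop
  have h0 : (fun x : Fin k → K => ⟪productVector b x, y⟫_ℂ) = fun _ => 0 := by
    refine hcont.ext_on hd continuous_const fun x hx => ?_
    exact (Submodule.mem_orthogonal _ _).1 hy _ (Submodule.subset_span ⟨x, hx, rfl⟩)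
  ext a
  have h1 := congrFun h0 fun i => b (a i)
  have h2 : productVector b (fun i => b (a i)) = lp.single 2 a (1 : ℂ) := by
    ext c
    rw [productVector_apply, lp.coeFn_single, Pi.single_apply]
    simp only [HilbertBasis.repr_self, lp.coeFn_single, Pi.single_apply]
    split_ifs with h
    · subst h
      simp
    · obtain ⟨j, hj⟩ := Function.ne_iff.1 h
      exact Finset.prod_eq_zero (Finset.mem_univ j) (by simp [hj])
  simp only [h2, lp.inner_single_left] at h1
  simpa using h1

end ProductVector

/-! ### The Hamiltonian on the tensor power -/

section Hamiltonian

variable {K : Type*} [NormedAddCommGroup K] [InnerProductSpace ℂ K] {ι : Type*}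

/-- The algebraic span of the pairs `(x, ∑ᵢ Hᵢ x)` for product vectors `x`. -/
noncomputable def iidGraph (b : HilbertBasis ι ℂ K) (H : K →ₗ.[ℂ] K) (k : ℕ) :
    Submodule ℂ (HilbertTensorPower ι k × HilbertTensorPower ι k) :=
  Submodule.span ℂ {p : HilbertTensorPower ι k × HilbertTensorPower ι k |
    ∃ x : Fin k → H.domain, p = (productVector b fun j => (x j : K),
      ∑ i, productVector b (Function.update (fun j => (x j : K)) i (H (x i))))}

/-- Symmetry is checked on product vectors, passes to the span by sesquilinearity and to the closure
by continuity, one argument at a time. -/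
theorem inner_iidGraph_closure (b : HilbertBasis ι ℂ K) {H : K →ₗ.[ℂ] K}
    (hH : H.IsFormalAdjoint H) (k : ℕ) {p q : HilbertTensorPower ι k × HilbertTensorPower ι k}
    (hp : p ∈ (iidGraph b H k).topologicalClosure) (hq : q ∈ (iidGraph b H k).topologicalClosure) :
    ⟪p.2, q.1⟫_ℂ = ⟪p.1, q.2⟫_ℂ := by
  have key : ∀ p ∈ iidGraph b H k, ∀ q ∈ iidGraph b H k, ⟪p.2, q.1⟫_ℂ = ⟪p.1, q.2⟫_ℂ := by
    intro p hp q hq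
    induction hp using Submodule.span_induction with
    | zero => simp
    | add x y _ _ hx hy => simp [hx, hy]
    | smul c x _ hx => simp [hx]
    | mem p hp =>
      induction hq using Submodule.span_induction with
      | zero => simp
      | add x y _ _ hx hy => simp [hx, hy]
      | smul c x _ hx => simp [hx]
      | mem q hq =>
        obtain ⟨x, rfl⟩ := hp
        obtain ⟨y, rfl⟩ := hq
        simp only [sum_inner, inner_sum, inner_productVector]
        refine Finset.sum_congr rfl fun i _ => ?_
        rw [← Finset.mul_prod_erase _ _ (Finset.mem_univ i),
          ← Finset.mul_prod_erase Finset.univ (fun j => ⟪(x j : K), _⟫_ℂ) (Finset.mem_univ i)]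
        simp only [Function.update_self]
        rw [hH]
        congr 1
        refine Finset.prod_congr rfl fun j hj => ?_
        rw [Function.update_of_ne (Finset.ne_of_mem_erase hj),
          Function.update_of_ne (Finset.ne_of_mem_erase hj)]
  have h1 : ∀ q ∈ iidGraph b H k, ⟪p.2, q.1⟫_ℂ = ⟪p.1, q.2⟫_ℂ := fun q hq => by
    have hc : IsClosed {p : HilbertTensorPower ι k × HilbertTensorPower ι k |
        ⟪p.2, q.1⟫_ℂ = ⟪p.1, q.2⟫_ℂ} := isClosed_eq (by fun_prop) (by fun_prop)
    exact closure_minimal (fun p hp => key p hp q hq) hc hp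
  have hc : IsClosed {q : HilbertTensorPower ι k × HilbertTensorPower ι k |
      ⟪p.2, q.1⟫_ℂ = ⟪p.1, q.2⟫_ℂ} := isClosed_eq (by fun_prop) (by fun_prop)
  exact closure_minimal h1 hc hq

/-- The closure must be single-valued to be a graph: if it contains `(0, v)`, symmetry makes `v`
orthogonal to the dense span of product vectors. -/
theorem iidHamiltonian_graph (b : HilbertBasis ι ℂ K) {H : K →ₗ.[ℂ] K}
    (hH : H.IsFormalAdjoint H) (hd : Dense (H.domain : Set K)) (k : ℕ) :
    (iidHamiltonian b H k).graph = (iidGraph b H k).topologicalClosure := by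
  refine Submodule.toLinearPMap_graph_eq _ fun p hp hp0 => ?_
  have h : ∀ q ∈ iidGraph b H k, ⟪p.2, q.1⟫_ℂ = 0 := fun q hq => by
    rw [inner_iidGraph_closure b hH k hp (Submodule.le_topologicalClosure _ hq), hp0,
      inner_zero_left]
  refine (dense_span_productVector b k hd).eq_zero_of_inner_left ℂ fun v hv => ?_
  induction hv using Submodule.span_induction with
  | zero => simp
  | add x y _ _ hx hy => rw [inner_add_right, hx, hy, add_zero]
  | smul c x _ hx => rw [inner_smul_right, hx, mul_zero]
  | mem v hv =>
    obtain ⟨x, hx, rfl⟩ := hv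
    exact h _ (Submodule.subset_span ⟨fun i => ⟨x i, hx i⟩, rfl⟩)

theorem iidHamiltonian_isFormalAdjoint (b : HilbertBasis ι ℂ K) {H : K →ₗ.[ℂ] K}
    (hH : H.IsFormalAdjoint H) (hd : Dense (H.domain : Set K)) (k : ℕ) :
    (iidHamiltonian b H k).IsFormalAdjoint (iidHamiltonian b H k) := by
  intro x y
  have hx := (iidHamiltonian b H k).mem_graph x
  have hy := (iidHamiltonian b H k).mem_graph y
  rw [iidHamiltonian_graph b hH hd] at hx hy
  exact inner_iidGraph_closure b hH k hx hy

theorem mem_iidHamiltonian_graph (b : HilbertBasis ι ℂ K) {H : K →ₗ.[ℂ] K}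
    (hH : H.IsFormalAdjoint H) (hd : Dense (H.domain : Set K)) {k : ℕ} {x y : Fin k → K}
    (hxy : ∀ i, (x i, y i) ∈ H.graph) :
    (productVector b x, ∑ i, productVector b (Function.update x i (y i))) ∈
      (iidHamiltonian b H k).graph := by
  rw [iidHamiltonian_graph b hH hd]
  refine Submodule.le_topologicalClosure _ (Submodule.subset_span ?_)
  choose z hz1 hz2 using fun i => LinearPMap.mem_graph_iff _ |>.1 (hxy i)
  simp only at hz1 hz2
  obtain rfl : (fun i => (z i : K)) = x := funext hz1
  exact ⟨z, by simp only [hz2]⟩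

/-- Splits off the scalar `kE`. With `E` the mean energy, the remaining one-place terms are
orthogonal to `Ψ`, which yields growth like `√k` instead of `k`. -/
theorem mem_iidHamiltonian_graph_sub (b : HilbertBasis ι ℂ K) {H : K →ₗ.[ℂ] K}
    (hH : H.IsFormalAdjoint H) (hd : Dense (H.domain : Set K)) {k : ℕ} {x y : Fin k → K} (E : ℂ)
    (hxy : ∀ i, (x i, y i) ∈ H.graph) :
    (productVector b x, ∑ i, productVector b (Function.update x i (y i - E • x i))
      + ((k : ℂ) * E) • productVector b x) ∈ (iidHamiltonian b H k).graph := by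
  convert mem_iidHamiltonian_graph b hH hd hxy using 2
  simp_rw [productVector_update_sub_smul, Function.update_eq_self]
  rw [Finset.sum_sub_distrib, Finset.sum_const, Finset.card_univ, Fintype.card_fin, mul_smul,
    Nat.cast_smul_eq_nsmul]
  abel

end Hamiltonian

/-! ### One- and two-particle excitations of a product state -/

theorem norm_sum_sq_of_pairwise_inner_eq_zero {E α : Type*} [NormedAddCommGroup E]
    [InnerProductSpace ℂ E] (s : Finset α) (v : α → E)
    (h : ∀ p ∈ s, ∀ q ∈ s, p ≠ q → ⟪v p, v q⟫_ℂ = 0) :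
    ‖∑ p ∈ s, v p‖ ^ 2 = ∑ p ∈ s, ‖v p‖ ^ 2 := by
  have h1 : ⟪∑ p ∈ s, v p, ∑ p ∈ s, v p⟫_ℂ = ∑ p ∈ s, ⟪v p, v p⟫_ℂ := by
    rw [sum_inner]
    refine Finset.sum_congr rfl fun p hp => ?_
    rw [inner_sum]
    exact Finset.sum_eq_single_of_mem p hp fun q hq hqp => h p hp q hq hqp.symm
  simp_rw [inner_self_eq_norm_sq_to_K] at h1
  exact_mod_cast h1

section Excitation

variable {K : Type*} [NormedAddCommGroup K] [InnerProductSpace ℂ K] {ι : Type*}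

/-- The vector `∑ᵢ ψ ⊗ ⋯ ⊗ x ⊗ ⋯ ⊗ ψ`, with `x` in place `i`. -/
noncomputable def excitation (b : HilbertBasis ι ℂ K) (ψ : K) (k : ℕ) (x : K) :
    HilbertTensorPower ι k :=
  ∑ i, productVector b (Function.update (fun _ => ψ) i x)

variable {b : HilbertBasis ι ℂ K} {ψ : K}

theorem norm_iidVector (hψ : ‖ψ‖ = 1) (k : ℕ) : ‖iidVector b ψ k‖ = 1 := by
  simp [iidVector, norm_productVector, hψ]

theorem norm_productVector_update (hψ : ‖ψ‖ = 1) {k : ℕ} (i : Fin k) (x : K) :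
    ‖productVector b (Function.update (fun _ => ψ) i x)‖ = ‖x‖ := by
  rw [norm_productVector, ← Finset.mul_prod_erase _ _ (Finset.mem_univ i), Function.update_self,
    Finset.prod_eq_one, mul_one]
  intro j hj
  rw [Function.update_of_ne (Finset.ne_of_mem_erase hj), hψ]

theorem norm_excitation_le (hψ : ‖ψ‖ = 1) (k : ℕ) (x : K) :
    ‖excitation b ψ k x‖ ≤ k * ‖x‖ := by
  refine (norm_sum_le _ _).trans ?_
  simp [norm_productVector_update hψ]

theorem inner_productVector_update (hψ : ‖ψ‖ = 1) {k : ℕ} (i : Fin k) (x y : K) :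
    ⟪productVector b (Function.update (fun _ => ψ) i x),
      productVector b (Function.update (fun _ => ψ) i y)⟫_ℂ = ⟪x, y⟫_ℂ := by
  rw [inner_productVector, ← Finset.mul_prod_erase _ _ (Finset.mem_univ i), Function.update_self,
    Function.update_self, Finset.prod_eq_one, mul_one]
  intro j hj
  simp [Function.update_of_ne (Finset.ne_of_mem_erase hj), inner_self_eq_norm_sq_to_K, hψ]

theorem inner_productVector_update_of_ne {k : ℕ} {i j : Fin k} (hij : i ≠ j)
    {x : K} (hx : ⟪x, ψ⟫_ℂ = 0) (y : K) :
    ⟪productVector b (Function.update (fun _ => ψ) i x),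
      productVector b (Function.update (fun _ => ψ) j y)⟫_ℂ = 0 := by
  rw [inner_productVector]
  refine Finset.prod_eq_zero (Finset.mem_univ i) ?_
  rw [Function.update_self, Function.update_of_ne hij, hx]

theorem inner_excitation (hψ : ‖ψ‖ = 1) (k : ℕ) {x : K} (hx : ⟪x, ψ⟫_ℂ = 0) (y : K) :
    ⟪excitation b ψ k x, excitation b ψ k y⟫_ℂ = k * ⟪x, y⟫_ℂ := by
  simp only [excitation, sum_inner, inner_sum]
  have : ∀ i : Fin k, ∑ j : Fin k, ⟪productVector b (Function.update (fun _ => ψ) j x),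
      productVector b (Function.update (fun _ => ψ) i y)⟫_ℂ = ⟪x, y⟫_ℂ := fun i => by
    rw [Finset.sum_eq_single_of_mem i (Finset.mem_univ i)
      fun j _ hji => inner_productVector_update_of_ne hji hx y, inner_productVector_update hψ]
  simp [this]

/-- Excitations in different places are orthogonal because `x ⟂ ψ`, so the squares of the norms add.
-/
theorem norm_excitation_sq (hψ : ‖ψ‖ = 1) (k : ℕ) {x : K} (hx : ⟪x, ψ⟫_ℂ = 0) :
    ‖excitation b ψ k x‖ ^ 2 = k * ‖x‖ ^ 2 := by
  have h := inner_excitation (b := b) hψ k hx x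
  simp_rw [inner_self_eq_norm_sq_to_K] at h
  have h2 : ((‖excitation b ψ k x‖ ^ 2 : ℝ) : ℂ) = ((k * ‖x‖ ^ 2 : ℝ) : ℂ) := by
    push_cast
    exact h
  exact Complex.ofReal_injective h2

theorem inner_excitation_iidVector (k : ℕ) {x : K} (hx : ⟪x, ψ⟫_ℂ = 0) :
    ⟪excitation b ψ k x, iidVector b ψ k⟫_ℂ = 0 := by
  simp only [excitation, sum_inner, iidVector, inner_productVector]
  refine Finset.sum_eq_zero fun i _ => Finset.prod_eq_zero (Finset.mem_univ i) ?_
  rw [Function.update_self, hx]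

/-- The vector with `x` in place `i`, `y` in place `j` and `ψ` elsewhere. -/
noncomputable def twoExcitation (b : HilbertBasis ι ℂ K) (ψ : K) {k : ℕ} (i j : Fin k) (x y : K) :
    HilbertTensorPower ι k :=
  productVector b (Function.update (Function.update (fun _ => ψ) i x) j y)

theorem norm_twoExcitation (hψ : ‖ψ‖ = 1) {k : ℕ} {i j : Fin k} (hij : i ≠ j) (x y : K) :
    ‖twoExcitation b ψ i j x y‖ = ‖x‖ * ‖y‖ := by
  rw [twoExcitation, norm_productVector, ← Finset.mul_prod_erase _ _ (Finset.mem_univ j),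
    ← Finset.mul_prod_erase _ _ (Finset.mem_erase.2 ⟨hij, Finset.mem_univ i⟩),
    Function.update_self, Function.update_of_ne hij, Function.update_self, Finset.prod_eq_one]
  · ring
  · intro l hl
    simp only [Finset.mem_erase] at hl
    rw [Function.update_of_ne hl.2.1, Function.update_of_ne hl.1, hψ]

theorem inner_twoExcitation_eq_zero {k : ℕ} {i j i' j' : Fin k} (hij : i ≠ j)
    {x y : K} (hx : ⟪x, ψ⟫_ℂ = 0) (hy : ⟪y, ψ⟫_ℂ = 0)
    (h : (i ≠ i' ∧ i ≠ j') ∨ (j ≠ i' ∧ j ≠ j')) :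
    ⟪twoExcitation b ψ i j x y, twoExcitation b ψ i' j' x y⟫_ℂ = 0 := by
  rw [twoExcitation, twoExcitation, inner_productVector]
  rcases h with ⟨h1, h2⟩ | ⟨h1, h2⟩
  · refine Finset.prod_eq_zero (Finset.mem_univ i) ?_
    rw [Function.update_of_ne hij, Function.update_self, Function.update_of_ne h2,
      Function.update_of_ne h1, hx]
  · refine Finset.prod_eq_zero (Finset.mem_univ j) ?_
    rw [Function.update_self, Function.update_of_ne h2, Function.update_of_ne h1, hy]

/-- The triangle inequality would give order `k²`. Excitations of different unordered pairs are
orthogonal, so the at most `k²` squares add and the norm is of order `k`. The vectors for `(i, j)`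
and `(j, i)` may overlap; the sums over `i < j` and `j < i` are bounded separately, hence the factor
2. -/
theorem norm_sum_twoExcitation_le (hψ : ‖ψ‖ = 1) (k : ℕ) {x y : K}
    (hx : ⟪x, ψ⟫_ℂ = 0) (hy : ⟪y, ψ⟫_ℂ = 0) :
    ‖∑ p : Fin k × Fin k with p.1 ≠ p.2, twoExcitation b ψ p.1 p.2 x y‖ ≤
      2 * k * (‖x‖ * ‖y‖) := by
  have bound : ∀ s : Finset (Fin k × Fin k), (∀ p ∈ s, p.1 ≠ p.2) →
      (∀ p ∈ s, ∀ q ∈ s, p ≠ q → (p.1 ≠ q.1 ∧ p.1 ≠ q.2) ∨ (p.2 ≠ q.1 ∧ p.2 ≠ q.2)) →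
      ‖∑ p ∈ s, twoExcitation b ψ p.1 p.2 x y‖ ≤ k * (‖x‖ * ‖y‖) := by
    intro s hs hs2
    have hsq : ‖∑ p ∈ s, twoExcitation b ψ p.1 p.2 x y‖ ^ 2 ≤ (k * (‖x‖ * ‖y‖)) ^ 2 := by
      rw [norm_sum_sq_of_pairwise_inner_eq_zero s _ fun p hp q hq hpq =>
        inner_twoExcitation_eq_zero (hs p hp) hx hy (hs2 p hp q hq hpq),
        Finset.sum_congr rfl fun p hp => by rw [norm_twoExcitation hψ (hs p hp)],
        Finset.sum_const, nsmul_eq_mul, mul_pow (k : ℝ)]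
      gcongr
      have := Finset.card_le_univ s
      rw [Fintype.card_prod, Fintype.card_fin] at this
      rw [sq]
      exact_mod_cast this
    exact (pow_le_pow_iff_left₀ (norm_nonneg _) (by positivity) two_ne_zero).1 hsq
  have hsplit : (Finset.univ.filter fun p : Fin k × Fin k => p.1 ≠ p.2) =
      (Finset.univ.filter fun p : Fin k × Fin k => p.1 < p.2) ∪
      (Finset.univ.filter fun p : Fin k × Fin k => p.2 < p.1) := by
    ext p
    simp
  have hdisj : Disjoint (Finset.univ.filter fun p : Fin k × Fin k => p.1 < p.2)
      (Finset.univ.filter fun p : Fin k × Fin k => p.2 < p.1) :=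
    Finset.disjoint_filter.2 fun p _ h => h.not_gt
  rw [hsplit, Finset.sum_union hdisj]
  refine (norm_add_le _ _).trans ?_
  have h1 := bound (Finset.univ.filter fun p : Fin k × Fin k => p.1 < p.2)
    (fun p hp => by simp at hp; exact hp.ne) fun p hp q hq hpq => by
      simp only [Finset.mem_filter, Finset.mem_univ, true_and] at hp hq
      rw [Ne, Prod.ext_iff] at hpq
      omega
  have h2 := bound (Finset.univ.filter fun p : Fin k × Fin k => p.2 < p.1)
    (fun p hp => by simp at hp; exact hp.ne') fun p hp q hq hpq => by
      simp only [Finset.mem_filter, Finset.mem_univ, true_and] at hp hq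
      rw [Ne, Prod.ext_iff] at hpq
      omega
  linarith

end Excitation

/-! ### Action of the Hamiltonian on a product state and on its one-particle excitations. -/

section ExcitationHamiltonian

variable {K : Type*} [NormedAddCommGroup K] [InnerProductSpace ℂ K] {ι : Type*}

theorem iidVector_mem_graph (b : HilbertBasis ι ℂ K) {H : K →ₗ.[ℂ] K}
    (hH : H.IsFormalAdjoint H) (hd : Dense (H.domain : Set K)) (k : ℕ) {ψ y : K} (E : ℂ)
    (hy : (ψ, y) ∈ H.graph) :
    (iidVector b ψ k, excitation b ψ k (y - E • ψ) + ((k : ℂ) * E) • iidVector b ψ k) ∈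
      (iidHamiltonian b H k).graph :=
  mem_iidHamiltonian_graph_sub b hH hd E fun _ => hy

/-- In each summand `H - E` acts either on the place of `η`, or on some `ψ`, where it creates a
second excitation `y - E • ψ`. -/
theorem excitation_mem_graph (b : HilbertBasis ι ℂ K) {H : K →ₗ.[ℂ] K}
    (hH : H.IsFormalAdjoint H) (hd : Dense (H.domain : Set K)) (k : ℕ) {ψ y η ζ : K} (E : ℂ)
    (hy : (ψ, y) ∈ H.graph) (hη : (η, ζ) ∈ H.graph) :
    (excitation b ψ k η, excitation b ψ k (ζ - E • η) +
        ∑ p : Fin k × Fin k with p.1 ≠ p.2, twoExcitation b ψ p.1 p.2 η (y - E • ψ) +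
        ((k : ℂ) * E) • excitation b ψ k η) ∈ (iidHamiltonian b H k).graph := by
  have h : ∀ i : Fin k, (productVector b (Function.update (fun _ => ψ) i η),
      productVector b (Function.update (fun _ => ψ) i (ζ - E • η)) +
      ∑ j with i ≠ j, twoExcitation b ψ i j η (y - E • ψ) +
      ((k : ℂ) * E) • productVector b (Function.update (fun _ => ψ) i η)) ∈
      (iidHamiltonian b H k).graph := fun i => by
    convert mem_iidHamiltonian_graph_sub b hH hd E (x := Function.update (fun _ => ψ) i η)
      (y := Function.update (fun _ => y) i ζ) fun j => ?_ using 3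
    · rw [← Finset.add_sum_erase _ _ (Finset.mem_univ i)]
      simp only [Function.update_self, Function.update_idem]
      congr 1
      refine Finset.sum_congr ?_ fun j hj => ?_
      · ext j
        simp [eq_comm]
      · rw [Finset.mem_erase] at hj
        simp only [Function.update_of_ne hj.1, twoExcitation]
    · by_cases hj : j = i
      · subst hj
        simpa using hη
      · simpa [hj] using hy
  have hs := Submodule.sum_mem _ fun i (_ : i ∈ Finset.univ) => h i
  convert hs using 1
  rw [Prod.ext_iff]
  constructor
  · simp [Prod.fst_sum, excitation]
  · simp only [Prod.snd_sum, Finset.sum_add_distrib, excitation, Finset.smul_sum]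
    congr 2
    rw [Finset.sum_filter, Fintype.sum_prod_type]
    simp_rw [Finset.sum_filter]

end ExcitationHamiltonian

/-! ### Lower semicontinuity of the variance at product states -/

section Variance

variable {K : Type*} [NormedAddCommGroup K] [InnerProductSpace ℂ K] {ι : Type*}

theorem isFormalAdjoint_inner_graph {E : Type*} [NormedAddCommGroup E] [InnerProductSpace ℂ E]
    {H : E →ₗ.[ℂ] E} (hH : H.IsFormalAdjoint H) {x y x' y' : E} (h : (x, y) ∈ H.graph)
    (h' : (x', y') ∈ H.graph) : ⟪y, x'⟫_ℂ = ⟪x, y'⟫_ℂ := by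
  obtain ⟨u, hu1, hu2⟩ := (LinearPMap.mem_graph_iff _).1 h
  obtain ⟨v, hv1, hv2⟩ := (LinearPMap.mem_graph_iff _).1 h'
  simp only at hu1 hu2 hv1 hv2
  rw [← hu1, ← hu2, ← hv1, ← hv2]
  exact hH u v

/-- If a symmetric operator shifted by `e` maps `χ` to `w` and `Ψ` to `u`, this bounds the overlap
of `w` with `Ψ` by the standard deviation of the operator in a state `φ` near `Ψ`. -/
theorem norm_inner_mul_le_of_graph {E : Type*} [NormedAddCommGroup E] [InnerProductSpace ℂ E]
    {A : E →ₗ.[ℂ] E} (hA : A.IsFormalAdjoint A) {Ψ u χ w φ g : E} (e c : ℂ)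
    (hΨ : ‖Ψ‖ = 1) (hφ : ‖φ‖ = 1)
    (hΨA : (Ψ, u + e • Ψ) ∈ A.graph) (hχA : (χ, w + e • χ) ∈ A.graph) (hφA : (φ, g) ∈ A.graph)
    (hχΨ : ⟪χ, Ψ⟫_ℂ = 0) (hα : 1 / 2 ≤ ‖⟪Ψ, φ⟫_ℂ‖) :
    ‖⟪Ψ, φ⟫_ℂ‖ * ‖⟪χ, u⟫_ℂ‖ ≤ ‖χ‖ * ‖g - c • φ‖ +
      √(1 - ‖⟪Ψ, φ⟫_ℂ‖ ^ 2) * (‖w‖ + 2 * (‖g - c • φ‖ + ‖u‖) * ‖χ‖) := by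
  set α := ⟪Ψ, φ⟫_ℂ with hαdef
  set V := g - c • φ with hV
  set φ' := φ - α • Ψ with hφ'
  have hΨΨ : ⟪Ψ, Ψ⟫_ℂ = 1 := by simp [inner_self_eq_norm_sq_to_K, hΨ]
  have hs : ‖φ'‖ = √(1 - ‖α‖ ^ 2) := by
    have horth : ⟪α • Ψ, φ'⟫_ℂ = 0 := by
      rw [hφ', inner_sub_right, inner_smul_left, inner_smul_left, inner_smul_right, hΨΨ, ← hαdef]
      ring
    have h1 := norm_add_sq_eq_norm_sq_add_norm_sq_of_inner_eq_zero (α • Ψ) φ' horth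
    rw [hφ', add_sub_cancel, hφ, norm_smul, hΨ, ← hφ'] at h1
    rw [eq_comm, Real.sqrt_eq_iff_mul_self_eq (by nlinarith [norm_nonneg φ']) (norm_nonneg _)]
    linarith
  set d : ℂ := starRingEnd ℂ e - c with hd
  have hΨV : ⟪Ψ, V⟫_ℂ = ⟪u, φ⟫_ℂ + d * α := by
    have h := isFormalAdjoint_inner_graph hA hΨA hφA
    rw [inner_add_left, inner_smul_left, ← hαdef] at h
    rw [hV, inner_sub_right, inner_smul_right, ← h, ← hαdef, hd]
    ring
  have hχV : ⟪χ, V⟫_ℂ = ⟪w, φ⟫_ℂ + d * ⟪χ, φ⟫_ℂ := by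
    have h := isFormalAdjoint_inner_graph hA hχA hφA
    rw [inner_add_left, inner_smul_left] at h
    rw [hV, inner_sub_right, inner_smul_right, ← h, hd]
    ring
  have hwΨ : ⟪w, Ψ⟫_ℂ = ⟪χ, u⟫_ℂ := by
    have h := isFormalAdjoint_inner_graph hA hχA hΨA
    rw [inner_add_left, inner_smul_left, inner_add_right, inner_smul_right, hχΨ] at h
    simpa using h
  -- Pairing with `Ψ` controls the unknown shift `d`; the factor 2 is the inverse of the lower bound
  -- 1/2 on the overlap.
  have hdle : ‖d‖ ≤ 2 * (‖V‖ + ‖u‖) := by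
    have h1 : d * α = ⟪Ψ, V⟫_ℂ - ⟪u, φ⟫_ℂ := by rw [hΨV]; ring
    have h2 : ‖d‖ * ‖α‖ ≤ ‖V‖ + ‖u‖ := by
      rw [← norm_mul, h1]
      refine (norm_sub_le _ _).trans (add_le_add ?_ ?_)
      · simpa [hΨ] using norm_inner_le_norm (𝕜 := ℂ) Ψ V
      · simpa [hφ] using norm_inner_le_norm (𝕜 := ℂ) u φ
    nlinarith [norm_nonneg d]
  have hφeq : φ = α • Ψ + φ' := by rw [hφ']; abel
  -- As `χ ⟂ Ψ` and `⟨w, Ψ⟩ = ⟨χ, u⟩`, the component of `φ` along `Ψ` contributes exactly `α ⟨χ,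
  -- u⟩`; all errors come from the small component `φ'`.
  have hmain : α * ⟪χ, u⟫_ℂ = ⟪χ, V⟫_ℂ - (⟪w, φ'⟫_ℂ + d * ⟪χ, φ'⟫_ℂ) := by
    rw [hχV, hφeq, inner_add_right, inner_add_right, inner_smul_right, inner_smul_right, hχΨ, hwΨ]
    ring
  rw [← norm_mul, hmain, ← hs]
  refine (norm_sub_le _ _).trans (add_le_add (norm_inner_le_norm χ V) ?_)
  refine (norm_add_le _ _).trans ?_
  rw [norm_mul, mul_add]
  refine add_le_add ((norm_inner_le_norm w φ').trans (mul_comm _ _).le) ?_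
  calc ‖d‖ * ‖⟪χ, φ'⟫_ℂ‖ ≤ (2 * (‖V‖ + ‖u‖)) * (‖χ‖ * ‖φ'‖) := by
        gcongr
        exact norm_inner_le_norm χ φ'
    _ = ‖φ'‖ * (2 * (‖V‖ + ‖u‖) * ‖χ‖) := by ring

/-- The functional `2|⟨η, h⟩| - ‖η‖²` has the value `‖h‖²` at `η = h`. Since `h` may lie outside the
domain, it is approximated from the dense domain; removing the `ψ` component stays in the domain
because `ψ` belongs to it. -/
theorem exists_mem_graph_orthogonal {H : K →ₗ.[ℂ] K} (hd : Dense (H.domain : Set K)) {ψ y h : K}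
    (hψ : ‖ψ‖ = 1) (hy : (ψ, y) ∈ H.graph) (hh : ⟪ψ, h⟫_ℂ = 0) {τ : ℝ} (hτ : 0 < τ) :
    ∃ η ζ, (η, ζ) ∈ H.graph ∧ ⟪η, ψ⟫_ℂ = 0 ∧ ‖h‖ ^ 2 - τ < 2 * ‖⟪η, h⟫_ℂ‖ - ‖η‖ ^ 2 := by
  let F : K → ℝ := fun x => 2 * ‖⟪x - ⟪ψ, x⟫_ℂ • ψ, h⟫_ℂ‖ - ‖x - ⟪ψ, x⟫_ℂ • ψ‖ ^ 2
  have hF : Continuous F := by fun_prop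
  have hFh : F h = ‖h‖ ^ 2 := by
    simp only [F, hh, zero_smul, sub_zero, inner_self_eq_norm_sq_to_K]
    simp
    ring
  have ho : IsOpen {x | ‖h‖ ^ 2 - τ < F x} := isOpen_lt continuous_const hF
  obtain ⟨x, hxF, hxd⟩ := hd.inter_open_nonempty _ ho ⟨h, by
    simp only [Set.mem_ofPred_eq, hFh]
    linarith⟩
  refine ⟨x - ⟪ψ, x⟫_ℂ • ψ, H ⟨x, hxd⟩ - ⟪ψ, x⟫_ℂ • y, ?_, ?_, hxF⟩
  · have h1 := H.graph.sub_mem (H.mem_graph ⟨x, hxd⟩) (H.graph.smul_mem ⟪ψ, x⟫_ℂ hy)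
    simpa using h1
  · rw [inner_sub_left, inner_smul_left, inner_conj_symm, inner_self_eq_norm_sq_to_K, hψ]
    simp

/-- The last step of the variance bound, with `v` the standard deviation, `x = ‖χ‖`, `n = ‖η‖²`, `B
= |⟨η, h⟩|`. It rests on `2xv ≤ x² + v²`; the condition on `t` makes the losses `2tk(B + C)` at most
`kτ/2`. -/
theorem variance_bound_arith {k a B C t n v x h₂ τ e r : ℝ} (hk : 0 ≤ k) (hB : 0 ≤ B)
    (ht : 0 ≤ t) (hη : h₂ - τ / 2 ≤ 2 * B - n) (htτ : t * (4 * (B + C + 1)) ≤ τ)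
    (hat : 1 - t ≤ a) (hx : x ^ 2 = k * n) (he : 0 ≤ e) (hr : r ≤ t) (hek : e ≤ k * C)
    (hmain : a * (k * B) ≤ x * v + r * e) : k * (h₂ - τ) ≤ v ^ 2 := by
  have h1 : r * e ≤ t * (k * C) := mul_le_mul hr hek he ht
  have h2 : 2 * (x * v) ≤ k * n + v ^ 2 := by nlinarith [sq_nonneg (x - v)]
  have h3 : (1 - t) * (k * B) ≤ a * (k * B) := by gcongr
  have h4 := mul_le_mul_of_nonneg_left hη hk
  have h5 := mul_le_mul_of_nonneg_left htτ hk
  have h6 : 0 ≤ k * t := mul_nonneg hk ht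
  linarith

/-- The main term and all errors in `norm_inner_mul_le_of_graph` are of order `k`, so `s` depends
only on `η`, `ζ`, `ψ`, `y` and `τ`. -/
theorem variance_iidHamiltonian_lower_bound (b : HilbertBasis ι ℂ K) {H : K →ₗ.[ℂ] K}
    (hH : H.IsFormalAdjoint H) (hd : Dense (H.domain : Set K)) {ψ y : K} (hψ : ‖ψ‖ = 1)
    (hy : (ψ, y) ∈ H.graph) {τ : ℝ} (hτ : 0 < τ) :
    ∃ s : ℝ, 0 < s ∧ ∀ (k : ℕ) (φ g : HilbertTensorPower ι k) (c : ℂ),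
      (φ, g) ∈ (iidHamiltonian b H k).graph → ‖φ‖ = 1 → 1 - s ≤ ‖⟪iidVector b ψ k, φ⟫_ℂ‖ ^ 2 →
      k * (‖y - ⟪ψ, y⟫_ℂ • ψ‖ ^ 2 - τ) ≤ ‖g - c • φ‖ ^ 2 := by
  set E := ⟪ψ, y⟫_ℂ with hE
  set h := y - E • ψ with hh
  have hψh : ⟪ψ, h⟫_ℂ = 0 := by
    rw [hh, inner_sub_right, inner_smul_right, inner_self_eq_norm_sq_to_K, hψ, ← hE]
    simp
  have hhψ : ⟪h, ψ⟫_ℂ = 0 := inner_eq_zero_symm.1 hψh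
  obtain ⟨η, ζ, hηH, hηψ, hη⟩ := exists_mem_graph_orthogonal hd hψ hy hψh (half_pos hτ)
  set B := ‖⟪η, h⟫_ℂ‖
  -- The 6 is 2 from the double excitations plus 4 from `2 (v + ‖u‖) ‖χ‖` with `v ≤ ‖u‖`, where `u`
  -- is the excitation by `h`.
  set C := ‖ζ - E • η‖ + 6 * (‖η‖ * ‖h‖) with hC
  have hB0 : 0 ≤ B := norm_nonneg _
  have hC0 : 0 ≤ C := by positivity
  set t := min (1 / 2) (τ / (4 * (B + C + 1))) with ht
  have ht0 : 0 < t := lt_min (by norm_num) (by positivity)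
  have ht1 : t ≤ 1 / 2 := min_le_left _ _
  have ht2 : t * (4 * (B + C + 1)) ≤ τ := by
    rw [← le_div_iff₀ (by positivity)]
    exact min_le_right _ _
  refine ⟨t ^ 2, by positivity, fun k φ g c hφA hφ hα => ?_⟩
  set Ψ := iidVector b ψ k with hΨdef
  have hΨ : ‖Ψ‖ = 1 := norm_iidVector hψ k
  have hα1 : ‖⟪Ψ, φ⟫_ℂ‖ ≤ 1 := by
    simpa [hΨ, hφ] using norm_inner_le_norm (𝕜 := ℂ) Ψ φ
  set a := ‖⟪Ψ, φ⟫_ℂ‖ with ha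
  have ha0 : 0 ≤ a := norm_nonneg _
  have hat : 1 - t ≤ a := by nlinarith
  -- The negated bound supplies `v ≤ ‖excitation b ψ k h‖`, which removes `v` from the error term.
  by_contra! hlt
  have hk0 : (0 : ℝ) ≤ k := Nat.cast_nonneg k
  set v := ‖g - c • φ‖ with hv
  have hv0 : 0 ≤ v := norm_nonneg _
  have hmain := norm_inner_mul_le_of_graph (iidHamiltonian_isFormalAdjoint b hH hd k)
    ((k : ℂ) * E) c hΨ hφ (iidVector_mem_graph b hH hd k E hy)
    (excitation_mem_graph b hH hd k E hy hηH) hφA (inner_excitation_iidVector k hηψ)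
    (by rw [← ha]; linarith)
  have hw : ‖excitation b ψ k (ζ - E • η) +
      ∑ p : Fin k × Fin k with p.1 ≠ p.2, twoExcitation b ψ p.1 p.2 η (y - E • ψ)‖ ≤
      k * (‖ζ - E • η‖ + 2 * (‖η‖ * ‖h‖)) := by
    refine (norm_add_le _ _).trans ?_
    have h1 := norm_excitation_le (b := b) hψ k (ζ - E • η)
    have h2 := norm_sum_twoExcitation_le (b := b) hψ k hηψ hhψ
    linarith
  have hu := norm_excitation_sq (b := b) hψ k hhψ
  have hχ := norm_excitation_sq (b := b) hψ k hηψ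
  rw [inner_excitation hψ k hηψ, norm_mul, Complex.norm_natCast, ← ha, ← hv, ← hh] at hmain
  clear_value v a
  have hvu : v ≤ ‖excitation b ψ k h‖ := by
    refine (pow_le_pow_iff_left₀ hv0 (norm_nonneg _) two_ne_zero).1 ?_
    rw [hu]
    nlinarith
  have huχ : ‖excitation b ψ k h‖ * ‖excitation b ψ k η‖ = k * (‖η‖ * ‖h‖) := by
    refine (pow_left_inj₀ (by positivity) (by positivity) two_ne_zero).1 ?_
    rw [mul_pow, hu, hχ]
    ring
  have hst : √(1 - a ^ 2) ≤ t := by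
    rw [Real.sqrt_le_left ht0.le]
    linarith
  have herr : ‖excitation b ψ k (ζ - E • η) +
      ∑ p : Fin k × Fin k with p.1 ≠ p.2, twoExcitation b ψ p.1 p.2 η h‖ +
      2 * (v + ‖excitation b ψ k h‖) * ‖excitation b ψ k η‖ ≤ k * C := by
    have h1 : 2 * (v + ‖excitation b ψ k h‖) * ‖excitation b ψ k η‖ ≤
        2 * (‖excitation b ψ k h‖ + ‖excitation b ψ k h‖) * ‖excitation b ψ k η‖ := by
      gcongr
    rw [hC]
    rw [← hh] at hw
    linarith
  exact absurd hlt (not_lt.2 (variance_bound_arith hk0 hB0 ht0.le hη.le ht2 hat hχ (by positivity)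
    hst herr hmain))

end Variance

/-! ### Scalar properties of regular standard monotone functions -/

namespace IsRegularStandardMonotone

variable {f : ℝ → ℝ}

open scoped ComplexOrder in
-- Scalars are `1 × 1` matrices.
theorem le_of_le (hf : IsRegularStandardMonotone f) {x y : ℝ} (hx : 0 ≤ x) (hxy : x ≤ y) :
    f x ≤ f y := by
  have hpos : ∀ r : ℝ, 0 ≤ r → (algebraMap ℝ (Matrix (Fin 1) (Fin 1) ℂ) r).PosSemidef :=
    fun r hr => by
      rw [Algebra.algebraMap_eq_smul_one]
      exact Matrix.PosSemidef.one.smul hr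
  have h := hf.operator_monotone 1 (algebraMap ℝ _ x) (algebraMap ℝ _ y) (hpos x hx)
    (by rw [← map_sub]; exact hpos _ (sub_nonneg.2 hxy))
  rw [cfc_algebraMap, cfc_algebraMap, ← map_sub] at h
  have h2 := h.diag_nonneg (i := 0)
  rw [Algebra.algebraMap_eq_smul_one] at h2
  have h3 : (0 : ℂ) ≤ ((f y - f x : ℝ) : ℂ) := by simpa using h2
  exact sub_nonneg.1 (Complex.zero_le_real.1 h3)

/-- Symmetry and monotonicity give `f x = x f(1/x) ≥ x f 1`. Positivity near 0 then passes to the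
limit `f 0`. -/
theorem le_apply_of_le_one (hf : IsRegularStandardMonotone f) {x : ℝ} (hx : 0 < x) (hx1 : x ≤ 1) :
    x ≤ f x := by
  rw [hf.symm x hx]
  have h : f 1 ≤ f (1 / x) := hf.le_of_le zero_le_one (by rwa [le_div_iff₀ hx, one_mul])
  rw [hf.one] at h
  nlinarith

theorem zero_pos (hf : IsRegularStandardMonotone f) : 0 < f 0 := by
  refine lt_of_le_of_ne ?_ hf.regular.symm
  refine ge_of_tendsto hf.tendsto_zero ?_
  filter_upwards [Ioc_mem_nhdsGT zero_lt_one] with x hx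
  exact hx.1.le.trans (hf.le_apply_of_le_one hx.1 hx.2)

theorem pos (hf : IsRegularStandardMonotone f) {x : ℝ} (hx : 0 ≤ x) : 0 < f x :=
  hf.zero_pos.trans_le (hf.le_of_le le_rfl hx)

theorem morozovaChentsov_comm (hf : IsRegularStandardMonotone f) {x y : ℝ} (hx : 0 ≤ x)
    (hy : 0 < y) : morozovaChentsov f y x = morozovaChentsov f x y := by
  rw [morozovaChentsov, morozovaChentsov, if_neg hy.ne']
  rcases hx.eq_or_lt with rfl | hx
  · simp
  · rw [if_neg hx.ne', hf.symm (y / x) (div_pos hy hx), one_div_div]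
    field_simp

/-- The weight of the top eigenvalue of a state at distance `d` from a pure state. -/
theorem le_weight (hf : IsRegularStandardMonotone f) {d x y : ℝ} (hd : 0 < d) (hd1 : d < 1 / 4)
    (hx : 0 ≤ x) (hxd : x ≤ 3 * d) (hy : 1 - d ≤ y) (hyd : y ≤ 1 + d) :
    f 0 * (1 - 4 * d) ^ 2 / ((1 + d) * f (3 * d / (1 - d))) / 2 ≤
      f 0 / 2 * ((x - y) ^ 2 * morozovaChentsov f x y) := by
  have hy0 : 0 < y := by linarith
  have h0 := hf.zero_pos
  have hxy : 0 ≤ x / y := by positivity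
  have hle : f (x / y) ≤ f (3 * d / (1 - d)) := by
    refine hf.le_of_le hxy ?_
    gcongr
    linarith
  have hfp := hf.pos hxy
  -- The eigenvalue gap is at least `(1 - d) - 3d`, positive since `d < 1/4`.
  have hsq : (1 - 4 * d) ^ 2 ≤ (x - y) ^ 2 := by nlinarith
  rw [morozovaChentsov, if_neg hy0.ne']
  calc f 0 * (1 - 4 * d) ^ 2 / ((1 + d) * f (3 * d / (1 - d))) / 2
      ≤ f 0 * (x - y) ^ 2 / (y * f (x / y)) / 2 := by gcongr
    _ = _ := by ring

theorem tendsto_weight (hf : IsRegularStandardMonotone f) :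
    Tendsto (fun d : ℝ => f 0 * (1 - 4 * d) ^ 2 / ((1 + d) * f (3 * d / (1 - d)))) (𝓝[>] 0)
      (𝓝 1) := by
  have h0 := hf.regular
  have h1 : Tendsto (fun d : ℝ => 3 * d / (1 - d)) (𝓝[>] 0) (𝓝[>] 0) := by
    refine tendsto_nhdsWithin_iff.2 ⟨?_, ?_⟩
    · have : ContinuousAt (fun d : ℝ => 3 * d / (1 - d)) 0 := by
        refine ContinuousAt.div (by fun_prop) (by fun_prop) (by norm_num)
      simpa using this.tendsto.mono_left nhdsWithin_le_nhds
    · filter_upwards [Ioo_mem_nhdsGT zero_lt_one] with d hd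
      rw [Set.mem_Ioo] at hd
      change 0 < 3 * d / (1 - d)
      exact div_pos (by linarith) (by linarith)
  have h2 := hf.tendsto_zero.comp h1
  have h3 : Tendsto (fun d : ℝ => f 0 * (1 - 4 * d) ^ 2) (𝓝[>] 0) (𝓝 (f 0)) := by
    have : Continuous (fun d : ℝ => f 0 * (1 - 4 * d) ^ 2) := by fun_prop
    simpa using (this.tendsto 0).mono_left nhdsWithin_le_nhds
  have h4 : Tendsto (fun d : ℝ => 1 + d) (𝓝[>] 0) (𝓝 1) := by
    have : Continuous (fun d : ℝ => 1 + d) := by fun_prop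
    simpa using (this.tendsto 0).mono_left nhdsWithin_le_nhds
  have h5 := h3.div (h4.mul h2) (by simpa using h0)
  rwa [one_mul, div_self h0] at h5

end IsRegularStandardMonotone

/-! ### The operator norm and the trace -/

section Trace

variable {E : Type*} [NormedAddCommGroup E] [InnerProductSpace ℂ E]

theorem hasSum_norm_inner_sq {w : Type*} (e : HilbertBasis w ℂ E) (x : E) :
    HasSum (fun i => ‖⟪e i, x⟫_ℂ‖ ^ 2) (‖x‖ ^ 2) := by
  have h := e.hasSum_inner_mul_inner x x
  have h2 := (Complex.hasSum_iff _ _).1 h |>.1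
  convert h2 using 1
  · ext i
    rw [← inner_conj_symm x (e i), Complex.conj_mul']
    norm_cast
  · rw [inner_self_eq_norm_sq_to_K]
    norm_cast

theorem tsum_enorm_inner_sq {w : Type*} (e : HilbertBasis w ℂ E) (x : E) :
    ∑' i, ‖⟪e i, x⟫_ℂ‖ₑ ^ 2 = ‖x‖ₑ ^ 2 := by
  have h := hasSum_norm_inner_sq e x
  have h2 := ENNReal.ofReal_tsum_of_nonneg (fun i => sq_nonneg ‖⟪e i, x⟫_ℂ‖) h.summable
  rw [h.tsum_eq] at h2
  simpa only [ENNReal.ofReal_pow (norm_nonneg _), ofReal_norm] using h2.symm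

variable [CompleteSpace E]

/-- With `S = √T`, the trace is the squared Hilbert–Schmidt norm of `S`, which dominates `‖S‖² ≥
‖T‖`. -/
theorem enorm_le_posTrace {T : E →L[ℂ] E} (hT : 0 ≤ T) : ‖T‖ₑ ≤ posTrace T := by
  set S := CFC.sqrt T with hS
  have hSS : S * S = T := CFC.sqrt_mul_sqrt_self T
  have hSsa : IsSelfAdjoint S := (CFC.sqrt_nonneg T).isSelfAdjoint
  have hadj : ∀ x y, ⟪S x, y⟫_ℂ = ⟪x, S y⟫_ℂ := hSsa.isSymmetric
  set e := (exists_hilbertBasis ℂ E).choose_spec.choose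
  have he : ⇑e = ((↑) : (exists_hilbertBasis ℂ E).choose → E) :=
    (exists_hilbertBasis ℂ E).choose_spec.choose_spec
  have htr : posTrace T = ∑' i, ‖S (e i)‖ₑ ^ 2 := by
    refine tsum_congr fun i => ?_
    rw [he, ← hSS, mul_apply_eq_comp, ← hadj, inner_self_eq_norm_sq,
      ENNReal.ofReal_pow (norm_nonneg _), ofReal_norm]
  have hSx : ∀ x, ‖S x‖ₑ ^ 2 ≤ posTrace T * ‖x‖ₑ ^ 2 := fun x => by
    rw [← tsum_enorm_inner_sq e, htr, ← ENNReal.tsum_mul_right]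
    refine ENNReal.tsum_le_tsum fun i => ?_
    rw [← hadj, ← mul_pow]
    gcongr
    rw [← ofReal_norm, ← ofReal_norm, ← ofReal_norm, ← ENNReal.ofReal_mul (norm_nonneg _)]
    exact ENNReal.ofReal_le_ofReal (norm_inner_le_norm _ _)
  by_cases htop : posTrace T = ⊤
  · rw [htop]
    exact le_top
  lift posTrace T to NNReal using htop with t ht
  have hnorm : ‖S‖ ≤ √(t : ℝ) := by
    refine S.opNorm_le_bound (Real.sqrt_nonneg _) fun x => ?_
    have h := hSx x
    rw [← ofReal_norm, ← ofReal_norm, ← ENNReal.ofReal_pow (norm_nonneg _),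
      ← ENNReal.ofReal_pow (norm_nonneg _), ← ENNReal.ofReal_coe_nnreal,
      ← ENNReal.ofReal_mul (by positivity), ENNReal.ofReal_le_ofReal_iff (by positivity)] at h
    refine (pow_le_pow_iff_left₀ (norm_nonneg _) (by positivity) two_ne_zero).1 ?_
    rwa [mul_pow, Real.sq_sqrt (by positivity)]
  rw [← ofReal_norm, ← ENNReal.ofReal_coe_nnreal]
  refine ENNReal.ofReal_le_ofReal ?_
  rw [← hSS]
  refine (norm_mul_le _ _).trans ?_
  have := Real.mul_self_sqrt (t.coe_nonneg)
  nlinarith [norm_nonneg S]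

theorem norm_sub_le_of_traceDist_le {ρ σ : E →L[ℂ] E} {ε : ℝ} (hε : 0 ≤ ε)
    (h : traceDist ρ σ ≤ ENNReal.ofReal ε) : ‖ρ - σ‖ ≤ 2 * ε := by
  rw [traceDist] at h
  have h1 := enorm_le_posTrace (CFC.abs_nonneg (ρ - σ))
  have h2 : ‖CFC.abs (ρ - σ)‖ₑ ≤ ENNReal.ofReal (2 * ε) := by
    refine h1.trans ?_
    rw [ENNReal.div_le_iff (by norm_num) (by norm_num)] at h
    rwa [mul_comm 2, ENNReal.ofReal_mul hε, ENNReal.ofReal_ofNat]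
  rw [← ofReal_norm, CFC.norm_abs, ENNReal.ofReal_le_ofReal_iff (by positivity)] at h2
  exact h2

end Trace

/-! ### The top eigenvector of a state near a pure state -/

section TopEigenvector

variable {E : Type*} [NormedAddCommGroup E] [InnerProductSpace ℂ E]

/-- Let `pᵢ = |⟨eᵢ, Ψ⟩|²`. Testing `ρ - |Ψ⟩⟨Ψ|` on `eᵢ` gives `|λᵢ - pᵢ| ≤ d`. The `p`-average of
the `λᵢ` is `⟨Ψ, ρΨ⟩ ≥ 1 - d`, so some `λᵢ ≥ 1 - d`. Its weight is at least `1 - 2d`, which leaves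
at most `2d` for any other weight and so `3d` for its eigenvalue. -/
theorem exists_top_eigenvector {ρ : E →L[ℂ] E} (hρ : ∀ x y, ⟪ρ x, y⟫_ℂ = ⟪x, ρ y⟫_ℂ)
    {Ψ : E} (hΨ : ‖Ψ‖ = 1) {d : ℝ} (hd : ‖ρ - pureState Ψ‖ ≤ d) {w : Type*}
    (e : HilbertBasis w ℂ E) (lam : w → ℝ) (hlam : ∀ i, ρ (e i) = (lam i : ℂ) • e i) :
    ∃ i₀, 1 - d ≤ lam i₀ ∧ lam i₀ ≤ 1 + d ∧ 1 - 2 * d ≤ ‖⟪Ψ, e i₀⟫_ℂ‖ ^ 2 ∧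
      ∀ j ≠ i₀, lam j ≤ 3 * d := by
  classical
  have hd0 : 0 ≤ d := (norm_nonneg _).trans hd
  have hp := hasSum_norm_inner_sq e Ψ
  rw [hΨ, one_pow] at hp
  have hnear : ∀ x : E, ‖x‖ = 1 → |RCLike.re ⟪x, ρ x⟫_ℂ - ‖⟪x, Ψ⟫_ℂ‖ ^ 2| ≤ d := fun x hx => by
    have h1 : ⟪x, (ρ - pureState Ψ) x⟫_ℂ = ⟪x, ρ x⟫_ℂ - (‖⟪x, Ψ⟫_ℂ‖ ^ 2 : ℝ) := by
      rw [sub_apply, inner_sub_right, pureState,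
        InnerProductSpace.rankOne_apply, inner_smul_right, ← inner_conj_symm Ψ x,
        Complex.conj_mul']
      norm_cast
    have h2 : RCLike.re ⟪x, ρ x⟫_ℂ - ‖⟪x, Ψ⟫_ℂ‖ ^ 2 = RCLike.re ⟪x, (ρ - pureState Ψ) x⟫_ℂ := by
      rw [h1, map_sub]
      simp [-Complex.ofReal_pow]
    rw [h2]
    refine (RCLike.abs_re_le_norm _).trans ((norm_inner_le_norm _ _).trans ?_)
    rw [hx, one_mul]
    refine ((ρ - pureState Ψ).le_opNorm x).trans ?_
    rwa [hx, mul_one]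
  have hlp : ∀ i, |lam i - ‖⟪e i, Ψ⟫_ℂ‖ ^ 2| ≤ d := fun i => by
    have he := e.orthonormal.1 i
    have h := hnear (e i) he
    rw [hlam, inner_smul_right, inner_self_eq_norm_sq_to_K, he] at h
    simpa using h
  have hle : ∀ i, ‖⟪e i, Ψ⟫_ℂ‖ ^ 2 ≤ 1 := fun i => by
    rw [← hp.tsum_eq]
    exact hp.summable.le_tsum i fun _ _ => sq_nonneg _
  have hsum : HasSum (fun i => lam i * ‖⟪e i, Ψ⟫_ℂ‖ ^ 2) (RCLike.re ⟪Ψ, ρ Ψ⟫_ℂ) := by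
    have h := ((Complex.hasSum_iff _ _).1 (e.hasSum_inner_mul_inner Ψ (ρ Ψ))).1
    refine h.congr_fun fun i => ?_
    rw [← hρ, hlam, inner_smul_left, ← inner_conj_symm Ψ (e i), mul_left_comm, Complex.conj_mul']
    simp [← Complex.ofReal_pow, ← Complex.ofReal_mul]
  have hex : ∃ i₀, 1 - d ≤ lam i₀ := by
    -- If all `λᵢ < 1 - d`, a series of nonnegative terms has sum 0, so every weight vanishes,
    -- although they sum to 1.
    by_contra! hlt
    have hΨρ := hnear Ψ hΨ
    rw [inner_self_eq_norm_sq_to_K, hΨ] at hΨρ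
    simp only [RCLike.ofReal_one, one_pow, norm_one, abs_le] at hΨρ
    have hs : HasSum (fun i => (1 - d - lam i) * ‖⟪e i, Ψ⟫_ℂ‖ ^ 2)
        ((1 - d) * 1 - RCLike.re ⟪Ψ, ρ Ψ⟫_ℂ) := by
      refine ((hp.mul_left (1 - d)).sub hsum).congr_fun fun i => ?_
      ring
    have hnn : ∀ i, 0 ≤ (1 - d - lam i) * ‖⟪e i, Ψ⟫_ℂ‖ ^ 2 := fun i =>
      mul_nonneg (by linarith [hlt i]) (sq_nonneg _)
    have h0 : (1 - d) * 1 - RCLike.re ⟪Ψ, ρ Ψ⟫_ℂ = 0 :=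
      le_antisymm (by linarith [hΨρ.1]) (hs.nonneg hnn)
    rw [h0, hasSum_zero_iff_of_nonneg hnn] at hs
    have hz : ∀ i, ‖⟪e i, Ψ⟫_ℂ‖ ^ 2 = 0 := fun i =>
      (mul_eq_zero.1 (congrFun hs i)).resolve_left (by linarith [hlt i])
    simp only [hz] at hp
    exact one_ne_zero (hp.unique hasSum_zero)
  obtain ⟨i₀, hi₀⟩ := hex
  have h0 := abs_le.1 (hlp i₀)
  refine ⟨i₀, hi₀, by linarith [hle i₀, h0.2], ?_, fun j hj => ?_⟩
  · rw [norm_inner_symm]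
    linarith [h0.2]
  · have hj2 := abs_le.1 (hlp j)
    have h2 : ‖⟪e i₀, Ψ⟫_ℂ‖ ^ 2 + ‖⟪e j, Ψ⟫_ℂ‖ ^ 2 ≤ 1 := by
      rw [← hp.tsum_eq, ← Finset.sum_pair (f := fun i => ‖⟪e i, Ψ⟫_ℂ‖ ^ 2) hj.symm]
      exact hp.summable.sum_le_tsum _ fun _ _ => sq_nonneg _
    linarith [h0.2, hj2.2]

end TopEigenvector

/-! ### Skew information and variance -/

section SkewInformation

variable {E : Type*} [NormedAddCommGroup E] [InnerProductSpace ℂ E] {H : E →ₗ.[ℂ] E}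

theorem matrixElementSq_right {u v g : E} (h : (v, g) ∈ H.graph) :
    matrixElementSq H u v = ‖⟪u, g⟫_ℂ‖ₑ ^ 2 := by
  obtain ⟨z, rfl, rfl⟩ := (LinearPMap.mem_graph_iff _).1 h
  rw [matrixElementSq, dif_pos z.2]

theorem matrixElementSq_left (hH : H.IsFormalAdjoint H) {u v g : E} (h : (u, g) ∈ H.graph) :
    matrixElementSq H u v = ‖⟪v, g⟫_ℂ‖ₑ ^ 2 := by
  have hsymm : ∀ x y : E, ‖⟪x, y⟫_ℂ‖ₑ = ‖⟪y, x⟫_ℂ‖ₑ := fun x y => by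
    rw [← ofReal_norm, ← ofReal_norm, norm_inner_symm]
  obtain ⟨z, rfl, rfl⟩ := (LinearPMap.mem_graph_iff _).1 h
  by_cases hv : v ∈ H.domain
  · rw [matrixElementSq, dif_pos hv, hsymm v, hH z ⟨v, hv⟩]
  · rw [matrixElementSq, dif_neg hv, dif_pos z.2, hsymm v]

theorem tsum_ite_enorm_inner_sq {w : Type*} [DecidableEq w] (e : HilbertBasis w ℂ E) (i₀ : w)
    (g : E) : ∑' j, (if j = i₀ then 0 else ‖⟪e j, g⟫_ℂ‖ₑ ^ 2) =
      ‖g - ⟪e i₀, g⟫_ℂ • e i₀‖ₑ ^ 2 := by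
  rw [← tsum_enorm_inner_sq e]
  refine tsum_congr fun j => ?_
  rw [inner_sub_right, inner_smul_right]
  split_ifs with h
  · subst h
    simp [inner_self_eq_norm_sq_to_K, e.orthonormal.1 j]
  · simp [e.orthonormal.2 h]

/-- Only row and column `i₀` are kept. By Parseval each contributes at least `κ/2` times the
variance in `e i₀`. -/
theorem le_skewSum {f : ℝ → ℝ} (hH : H.IsFormalAdjoint H) {w : Set E}
    [DecidableEq w] (e : HilbertBasis w ℂ E)
    (lam : w → ℝ) {i₀ : w} {g : E} (hg : (e i₀, g) ∈ H.graph) {κ : ℝ} (hκ : 0 ≤ κ)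
    (h1 : ∀ j ≠ i₀, κ / 2 ≤
      f 0 / 2 * ((lam j - lam i₀) ^ 2 * morozovaChentsov f (lam j) (lam i₀)))
    (h2 : ∀ j ≠ i₀, κ / 2 ≤
      f 0 / 2 * ((lam i₀ - lam j) ^ 2 * morozovaChentsov f (lam i₀) (lam j))) :
    ENNReal.ofReal (κ * ‖g - ⟪e i₀, g⟫_ℂ • e i₀‖ ^ 2) ≤ skewSum f H e lam := by
  rw [ENNReal.ofReal_mul hκ, ENNReal.ofReal_pow (norm_nonneg _), ofReal_norm,
    ← tsum_ite_enorm_inner_sq e i₀ g]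
  set t : w → ℝ≥0∞ := fun j => if j = i₀ then 0 else ‖⟪e j, g⟫_ℂ‖ₑ ^ 2 with ht
  have hκ2 : ENNReal.ofReal κ * ∑' j, t j =
      ∑' j, ENNReal.ofReal (κ / 2) * t j + ∑' j, ENNReal.ofReal (κ / 2) * t j := by
    rw [ENNReal.tsum_mul_left, ← add_mul, ← ENNReal.ofReal_add (by positivity) (by positivity),
      add_halves]
  let G : w → w → ℝ≥0∞ := fun i j =>
    ENNReal.ofReal (f 0 / 2 * ((lam i - lam j) ^ 2 * morozovaChentsov f (lam i) (lam j))) *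
      matrixElementSq H (e i) (e j)
  have hrow : ∀ j, ENNReal.ofReal (κ / 2) * t j ≤ G i₀ j := fun j => by
    by_cases hj : j = i₀
    · simp [ht, hj]
    · simp only [ht, if_neg hj, G]
      rw [matrixElementSq_left hH hg]
      exact mul_le_mul' (ENNReal.ofReal_le_ofReal (h2 j hj)) le_rfl
  have hcol : ∀ j, ENNReal.ofReal (κ / 2) * t j ≤ if j = i₀ then 0 else ∑' l, G j l := fun j => by
    by_cases hj : j = i₀
    · simp [ht, hj]
    · refine le_trans ?_ ((ENNReal.le_tsum (f := G j) i₀).trans (if_neg hj).ge)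
      simp only [ht, if_neg hj, G]
      rw [matrixElementSq_right hg]
      exact mul_le_mul' (ENNReal.ofReal_le_ofReal (h1 j hj)) le_rfl
  calc ENNReal.ofReal κ * ∑' j, t j
      ≤ ∑' j, G i₀ j + ∑' j, (if j = i₀ then 0 else ∑' l, G j l) :=
        hκ2.le.trans (add_le_add (ENNReal.tsum_le_tsum hrow) (ENNReal.tsum_le_tsum hcol))
    _ = ∑' i, ∑' j, G i j := 
        (Summable.tsum_eq_add_tsum_ite' (f := fun i => ∑' j, G i j) i₀ ENNReal.summable).symm

/-- For a projector only row and column `i₀` survive, with weight `f 0 / 2 · 1 / f 0 = 1/2` each. -/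
theorem skewSum_le {f : ℝ → ℝ} (hf0 : f 0 ≠ 0) (hH : H.IsFormalAdjoint H) {w : Set E}
    [DecidableEq w] (e : HilbertBasis w ℂ E) {i₀ : w} {g : E} (hg : (e i₀, g) ∈ H.graph) :
    skewSum f H e (fun i => if i = i₀ then 1 else 0) ≤
      ENNReal.ofReal (‖g - ⟪e i₀, g⟫_ℂ • e i₀‖ ^ 2) := by
  rw [ENNReal.ofReal_pow (norm_nonneg _), ofReal_norm, ← tsum_ite_enorm_inner_sq e i₀ g]
  set t : w → ℝ≥0∞ := fun j => if j = i₀ then 0 else ‖⟪e j, g⟫_ℂ‖ₑ ^ 2 with ht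
  have hhalf : f 0 / 2 * (f 0)⁻¹ = 2⁻¹ := by field_simp
  have hle : skewSum f H e (fun i => if i = i₀ then 1 else 0) ≤
      ∑' (i : w) (j : w), ((if i = i₀ then ENNReal.ofReal (1 / 2) * t j else 0) +
        (if j = i₀ then ENNReal.ofReal (1 / 2) * t i else 0)) := by
    refine ENNReal.tsum_le_tsum fun i => ENNReal.tsum_le_tsum fun j => ?_
    by_cases hi : i = i₀ <;> by_cases hj : j = i₀
    · simp [hi, hj]
    · subst hi
      rw [matrixElementSq_left hH hg]
      simp [ht, hj, morozovaChentsov, hhalf]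
    · subst hj
      rw [matrixElementSq_right hg]
      simp [ht, hi, morozovaChentsov, hhalf]
    · simp [hi, hj]
  refine hle.trans (le_of_eq ?_)
  simp_rw [ENNReal.tsum_add]
  have hA : ∑' (i : w) (j : w), (if i = i₀ then ENNReal.ofReal (1 / 2) * t j else 0) =
      ENNReal.ofReal (1 / 2) * ∑' j, t j := by
    rw [tsum_eq_single i₀ fun i hi => by simp [hi]]
    simp [ENNReal.tsum_mul_left]
  have hB : ∑' (i : w) (j : w), (if j = i₀ then ENNReal.ofReal (1 / 2) * t i else 0) =
      ENNReal.ofReal (1 / 2) * ∑' j, t j := by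
    rw [← ENNReal.tsum_mul_left]
    exact tsum_congr fun i => tsum_ite_eq i₀ _
  rw [hA, hB, ← add_mul, ← ENNReal.ofReal_add (by norm_num) (by norm_num)]
  norm_num

variable [CompleteSpace E]

/-- The infimum over eigenbases is bounded by a single one, an extension of `Ψ` to an orthonormal
basis. -/
theorem skewInformation_pureState_le {f : ℝ → ℝ} (hf0 : f 0 ≠ 0) (hH : H.IsFormalAdjoint H)
    {Ψ g : E} (hΨ : ‖Ψ‖ = 1) (hg : (Ψ, g) ∈ H.graph) :
    skewInformation f (pureState Ψ) H ≤ ENNReal.ofReal (‖g - ⟪Ψ, g⟫_ℂ • Ψ‖ ^ 2) := by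
  classical
  have hs : Orthonormal ℂ ((↑) : ({Ψ} : Set E) → E) := by
    refine ⟨fun i => ?_, fun i j hij => absurd (Subsingleton.elim i j) hij⟩
    rw [Set.mem_singleton_iff.1 i.2, hΨ]
  obtain ⟨w, e, hw, he⟩ := hs.exists_hilbertBasis_extension
  set i₀ : w := ⟨Ψ, hw (Set.mem_singleton Ψ)⟩ with hi₀
  have he0 : e i₀ = Ψ := by rw [he]
  have hmain := skewSum_le hf0 hH e (i₀ := i₀) (g := g) (by rwa [he0])
  rw [he0] at hmain
  refine le_trans ?_ hmain
  refine iInf_le_of_le w (iInf_le_of_le e (iInf_le_of_le (fun i => if i = i₀ then 1 else 0)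
    (iInf_le_of_le (fun i => ?_) (iInf_le_of_le (fun i hi => ?_) le_rfl))))
  · rw [pureState, InnerProductSpace.rankOne_apply]
    dsimp only
    split_ifs with h
    · rw [h, he0, inner_self_eq_norm_sq_to_K, hΨ]
      simp
    · have : ⟪e i₀, e i⟫_ℂ = 0 := e.orthonormal.2 (Ne.symm h)
      rw [he0] at this
      simp [this]
  · have h : i = i₀ := by
      by_contra h
      simp [h] at hi
    rw [h, he0]
    exact LinearPMap.mem_domain_of_mem_graph hg

/-- The bound holds in every eigenbasis: each contains a top eigenvector, and its nonzero eigenvalue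
places it in the domain. -/
theorem le_skewInformation {f : ℝ → ℝ} (hf : IsRegularStandardMonotone f)
    (hH : H.IsFormalAdjoint H) {ρ : E →L[ℂ] E} (hρ : IsDensityOperator ρ) {Ψ : E} (hΨ : ‖Ψ‖ = 1)
    {d : ℝ} (hd0 : 0 < d) (hd1 : d < 1 / 4) (hd : ‖ρ - pureState Ψ‖ ≤ d) {B : ℝ}
    (hB : ∀ φ g, (φ, g) ∈ H.graph → ‖φ‖ = 1 → 1 - 2 * d ≤ ‖⟪Ψ, φ⟫_ℂ‖ ^ 2 →
      B ≤ ‖g - ⟪φ, g⟫_ℂ • φ‖ ^ 2) :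
    ENNReal.ofReal (f 0 * (1 - 4 * d) ^ 2 / ((1 + d) * f (3 * d / (1 - d))) * B) ≤
      skewInformation f ρ H := by
  refine le_iInf fun w => le_iInf fun e => le_iInf fun lam => le_iInf fun hlam =>
    le_iInf fun hdom => ?_
  classical
  obtain ⟨i₀, hi1, hi2, hi3, hi4⟩ :=
    exists_top_eigenvector hρ.1.isSymmetric hΨ hd e lam hlam
  have hpos : ∀ j, 0 ≤ lam j := fun j => by
    have h := hρ.1.re_inner_nonneg_right (e j)
    rw [hlam, inner_smul_right, inner_self_eq_norm_sq_to_K, e.orthonormal.1 j] at h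
    simpa using h
  have hl0 : 0 < lam i₀ := by linarith
  have hg := H.mem_graph ⟨e i₀, hdom i₀ hl0.ne'⟩
  set g := H ⟨e i₀, hdom i₀ hl0.ne'⟩
  have hκ : 0 ≤ f 0 * (1 - 4 * d) ^ 2 / ((1 + d) * f (3 * d / (1 - d))) := by
    have := hf.zero_pos
    have := hf.pos (x := 3 * d / (1 - d)) (div_nonneg (by linarith) (by linarith))
    positivity
  have hw : ∀ j ≠ i₀, _ := fun j hj =>
    hf.le_weight hd0 hd1 (hpos j) (hi4 j hj) hi1 hi2
  refine le_trans (ENNReal.ofReal_le_ofReal ?_) (le_skewSum hH e lam hg hκ hw fun j hj => ?_)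
  · exact mul_le_mul_of_nonneg_left (hB _ _ hg (e.orthonormal.1 i₀) hi3) hκ
  · rw [hf.morozovaChentsov_comm (hpos j) hl0, sub_sq_comm (lam i₀)]
    exact hw j hj

end SkewInformation

/-! ### Finite moments and the domain of the Hamiltonian -/

section Domain

theorem norm_exp_neg_I_mul_sub_one_le (t x : ℝ) :
    ‖Complex.exp (-Complex.I * t * x) - 1‖ ≤ |t| * |x| := by
  have h := Real.norm_exp_I_mul_ofReal_sub_one_le (x := -(t * x))
  rw [Real.norm_eq_abs, abs_neg, abs_mul] at h
  convert h using 4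
  push_cast
  ring

theorem integrable_sq_of_lintegral_pow_three {μ : Measure ℝ} [IsFiniteMeasure μ]
    (h : ∫⁻ x : ℝ, ‖x‖ₑ ^ 3 ∂μ < ⊤) : Integrable (fun x : ℝ => x ^ 2) μ := by
  have h3 : Integrable (fun x : ℝ => x ^ 3) μ := by
    refine ⟨by fun_prop, ?_⟩
    simpa [HasFiniteIntegral, enorm_pow] using h
  refine ((integrable_const (1 : ℝ)).add h3.norm).mono (by fun_prop) (ae_of_all _ fun x => ?_)
  simp only [Pi.add_apply, norm_pow, Real.norm_eq_abs]
  rw [abs_of_nonneg (a := 1 + |x| ^ 3) (by positivity)]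
  nlinarith [abs_nonneg x, sq_nonneg (|x| - 1), mul_nonneg (abs_nonneg x) (sq_nonneg (|x| - 1))]

variable {E : Type*} [NormedAddCommGroup E] [InnerProductSpace ℂ E] {H : E →ₗ.[ℂ] E}
  {U : ℝ → E →L[ℂ] E}

/-- The difference quotients of `t ↦ e^{-itx}` converge to `-ix` in `L²(μ)`. -/
theorem tendsto_integral_differenceQuotient {μ : Measure ℝ} [IsFiniteMeasure μ]
    (h : Integrable (fun x : ℝ => x ^ 2) μ) :
    Tendsto (fun t : ℝ => ∫ x : ℝ,
      ‖(t : ℂ)⁻¹ * (Complex.exp (-Complex.I * t * x) - 1) + Complex.I * x‖ ^ 2 ∂μ) (𝓝[≠] 0)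
      (𝓝 0) := by
  have h0 : 𝓝 (0 : ℝ) = 𝓝 (∫ _x : ℝ, (0 : ℝ) ∂μ) := by simp
  refine Tendsto.mono_right ?_ h0.ge
  refine tendsto_integral_filter_of_dominated_convergence (fun x => 4 * x ^ 2) ?_ ?_
    (h.const_mul 4) ?_
  · exact Eventually.of_forall fun t => by fun_prop
  · filter_upwards [self_mem_nhdsWithin] with t ht
    refine ae_of_all _ fun x => ?_
    have ht0 : 0 < |t| := abs_pos.2 ht
    have h1 : ‖(t : ℂ)⁻¹ * (Complex.exp (-Complex.I * t * x) - 1)‖ ≤ |x| := by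
      rw [norm_mul, norm_inv, Complex.norm_real, Real.norm_eq_abs, inv_mul_le_iff₀ ht0]
      exact norm_exp_neg_I_mul_sub_one_le t x
    have h2 : ‖Complex.I * (x : ℂ)‖ = |x| := by simp
    have h3 := norm_add_le ((t : ℂ)⁻¹ * (Complex.exp (-Complex.I * t * x) - 1)) (Complex.I * x)
    rw [h2] at h3
    rw [norm_pow, norm_norm, ← sq_abs x]
    nlinarith [norm_nonneg ((t : ℂ)⁻¹ * (Complex.exp (-Complex.I * t * x) - 1) + Complex.I * x)]
  · refine ae_of_all _ fun x => ?_
    have hd : HasDerivAt (fun t : ℝ => Complex.exp (-Complex.I * t * x)) (-Complex.I * x) 0 := by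
      have h1 : HasDerivAt (fun t : ℝ => -Complex.I * t * x) (-Complex.I * x) 0 := by
        have := ((Complex.ofRealCLM.hasDerivAt (x := (0 : ℝ))).const_mul (-Complex.I)).mul_const
          (x : ℂ)
        simpa using this
      simpa using h1.cexp
    have h2 := (hasDerivAt_iff_tendsto_slope.1 hd).add_const (Complex.I * x)
    have h3 := (h2.norm).pow 2
    simp only [neg_mul, neg_add_cancel, norm_zero, ne_eq, OfNat.ofNat_ne_zero, not_false_eq_true,
      zero_pow] at h3
    refine h3.congr fun t => ?_
    simp [slope_def_module]

theorem IsTimeEvolution.inner_apply [CompleteSpace E] (hU : IsTimeEvolution H U) (φ : E)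
    (s t : ℝ) : ⟪U s φ, U t φ⟫_ℂ = ⟪φ, U (t - s) φ⟫_ℂ := by
  have h : U t = U s * U (t - s) := by rw [← hU.add, add_sub_cancel]
  rw [h, mul_apply_eq_comp, ← ContinuousLinearMap.adjoint_inner_right,
    ← ContinuousLinearMap.star_eq_adjoint, ← mul_apply_eq_comp,
    (Unitary.mem_iff.1 (hU.unitary s)).1]
  rfl

/-- `U t φ ↦ e^{-itx}` extends to an isometry into `L²(μ)`, since inner products of the `U t φ`
depend only on time differences. This serves in place of the spectral theorem. -/
theorem IsTimeEvolution.norm_sum_smul_sq [CompleteSpace E] (hU : IsTimeEvolution H U) {φ : E}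
    {μ : Measure ℝ} [IsFiniteMeasure μ]
    (hμ : ∀ t : ℝ, ⟪φ, U t φ⟫_ℂ = ∫ x : ℝ, Complex.exp (-Complex.I * t * x) ∂μ)
    {α : Type*} (S : Finset α) (t : α → ℝ) (a : α → ℂ) :
    ‖∑ i ∈ S, a i • U (t i) φ‖ ^ 2 =
      ∫ x : ℝ, ‖∑ i ∈ S, a i * Complex.exp (-Complex.I * t i * x)‖ ^ 2 ∂μ := by
  have hint : ∀ s : ℝ, Integrable (fun x : ℝ => Complex.exp (-Complex.I * s * x)) μ := fun s => by
    refine (integrable_const (1 : ℝ)).mono' (by fun_prop) (ae_of_all _ fun x => ?_)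
    rw [Complex.norm_exp]
    simp
  have h : ((‖∑ i ∈ S, a i • U (t i) φ‖ ^ 2 : ℝ) : ℂ) =
      ((∫ x : ℝ, ‖∑ i ∈ S, a i * Complex.exp (-Complex.I * t i * x)‖ ^ 2 ∂μ : ℝ) : ℂ) := by
    rw [← integral_complex_ofReal]
    have hx : ∀ x : ℝ, ((‖∑ i ∈ S, a i * Complex.exp (-Complex.I * t i * x)‖ ^ 2 : ℝ) : ℂ) =
        ∑ i ∈ S, ∑ j ∈ S, starRingEnd ℂ (a i) * a j *
          Complex.exp (-Complex.I * ((t j - t i : ℝ) : ℂ) * x) := fun x => by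
      rw [Complex.ofReal_pow, ← Complex.conj_mul', map_sum, Finset.sum_mul_sum]
      refine Finset.sum_congr rfl fun i _ => Finset.sum_congr rfl fun j _ => ?_
      rw [map_mul, ← Complex.exp_conj, mul_mul_mul_comm, ← Complex.exp_add]
      congr 2
      simp
      ring
    simp_rw [hx]
    rw [integral_finsetSum _ fun i _ => integrable_finsetSum _ fun j _ =>
      (hint _).const_mul _]
    rw [Complex.ofReal_pow]
    have hself := inner_self_eq_norm_sq_to_K (𝕜 := ℂ) (∑ i ∈ S, a i • U (t i) φ)
    refine hself.symm.trans ?_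
    rw [sum_inner]
    refine Finset.sum_congr rfl fun i _ => ?_
    rw [inner_sum, integral_finsetSum _ fun j _ => (hint _).const_mul _]
    refine Finset.sum_congr rfl fun j _ => ?_
    rw [inner_smul_left, inner_smul_right, hU.inner_apply, hμ, integral_const_mul, mul_assoc]
  exact Complex.ofReal_injective h

/-- The difference quotients of `U t φ` at 0 correspond isometrically to those of `e^{-itx}`, which
converge in `L²(μ)` when `x²` is integrable. They are therefore Cauchy, and the limit is the
derivative that puts `φ` in the domain. -/
theorem IsTimeEvolution.exists_mem_graph [CompleteSpace E] (hU : IsTimeEvolution H U) {φ : E}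
    {μ : Measure ℝ} [IsFiniteMeasure μ]
    (hμ : ∀ t : ℝ, ⟪φ, U t φ⟫_ℂ = ∫ x : ℝ, Complex.exp (-Complex.I * t * x) ∂μ)
    (hm : Integrable (fun x : ℝ => x ^ 2) μ) : ∃ y, (φ, y) ∈ H.graph := by
  set D : ℝ → E := slope (fun t => U t φ) 0 with hD
  have hDt : ∀ t, D t = (t : ℂ)⁻¹ • (U t φ - U 0 φ) := fun t => by
    rw [hD, slope_def_module, sub_zero, ← Complex.ofReal_inv]
    rfl
  set q : ℝ → ℝ → ℂ := fun t x => (t : ℂ)⁻¹ * (Complex.exp (-Complex.I * t * x) - 1) with hq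
  set G : ℝ → ℝ := fun t => ∫ x : ℝ, ‖q t x + Complex.I * x‖ ^ 2 ∂μ with hG
  have hG0 : Tendsto G (𝓝[≠] 0) (𝓝 0) := tendsto_integral_differenceQuotient hm
  have hqint : ∀ t, Integrable (fun x => ‖q t x + Complex.I * x‖ ^ 2) μ := fun t => by
    have hi : Integrable (fun x : ℝ => 2 * (|t⁻¹| * 2) ^ 2 + 2 * x ^ 2) μ :=
      (integrable_const _).add (hm.const_mul 2)
    refine hi.mono' (by fun_prop) (ae_of_all _ fun x => ?_)
    have h1 : ‖q t x‖ ≤ |t⁻¹| * 2 := by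
      rw [hq, norm_mul, ← Complex.ofReal_inv, Complex.norm_real, Real.norm_eq_abs]
      gcongr
      refine (norm_sub_le _ _).trans ?_
      rw [Complex.norm_exp]
      simp
      norm_num
    have h2 : ‖Complex.I * (x : ℂ)‖ = |x| := by simp
    have h3 := norm_add_le (q t x) (Complex.I * x)
    rw [h2] at h3
    rw [norm_pow, norm_norm, ← sq_abs x]
    have h4 : ‖q t x + Complex.I * x‖ ≤ |t⁻¹| * 2 + |x| := by linarith
    have h5 := pow_le_pow_left₀ (norm_nonneg _) h4 2
    nlinarith [sq_nonneg (|t⁻¹| * 2 - |x|)]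
  have hdist : ∀ s t, ‖D t - D s‖ ^ 2 ≤ 2 * G t + 2 * G s := fun s t => by
    have h1 : D t - D s = ∑ i : Fin 3, (![(t : ℂ)⁻¹, -(s : ℂ)⁻¹, (s : ℂ)⁻¹ - (t : ℂ)⁻¹] i) •
        U (![t, s, 0] i) φ := by
      rw [hDt, hDt, Fin.sum_univ_three]
      simp only [Matrix.cons_val, smul_sub, sub_smul, neg_smul]
      abel
    rw [h1, hU.norm_sum_smul_sq hμ, hG]
    simp only
    rw [← integral_const_mul, ← integral_const_mul,
      ← integral_add ((hqint t).const_mul 2) ((hqint s).const_mul 2)]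
    refine integral_mono_of_nonneg (ae_of_all _ fun x => sq_nonneg _)
      (((hqint t).const_mul 2).add ((hqint s).const_mul 2)) (ae_of_all _ fun x => ?_)
    have h2 : ∑ i : Fin 3, (![(t : ℂ)⁻¹, -(s : ℂ)⁻¹, (s : ℂ)⁻¹ - (t : ℂ)⁻¹] i) *
        Complex.exp (-Complex.I * (![t, s, 0] i : ℝ) * x) =
        (q t x + Complex.I * x) - (q s x + Complex.I * x) := by
      rw [Fin.sum_univ_three]
      simp only [Matrix.cons_val, hq, Complex.ofReal_zero, mul_zero, zero_mul, Complex.exp_zero]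
      ring
    simp only [h2]
    have h3 := norm_sub_le (q t x + Complex.I * x) (q s x + Complex.I * x)
    have h4 := pow_le_pow_left₀ (norm_nonneg _) h3 2
    nlinarith [sq_nonneg (‖q t x + Complex.I * x‖ - ‖q s x + Complex.I * x‖)]
  have hcauchy : Cauchy (map D (𝓝[≠] 0)) := by
    refine Metric.cauchy_iff.2 ⟨inferInstance, fun ε hε => ?_⟩
    have hev : {t | G t < ε ^ 2 / 4} ∈ 𝓝[≠] (0 : ℝ) :=
      hG0.eventually (gt_mem_nhds (by positivity))
    refine ⟨D '' {t | G t < ε ^ 2 / 4}, image_mem_map hev, ?_⟩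
    rintro _ ⟨t, ht, rfl⟩ _ ⟨s, hs, rfl⟩
    rw [dist_eq_norm]
    have h1 := hdist s t
    have ht' : G t < ε ^ 2 / 4 := ht
    have hs' : G s < ε ^ 2 / 4 := hs
    exact lt_of_pow_lt_pow_left₀ 2 hε.le (by linarith)
  obtain ⟨z, hz⟩ := CompleteSpace.complete hcauchy
  refine ⟨Complex.I • z, (hU.generator φ _).2 ?_⟩
  rw [smul_smul, neg_mul, Complex.I_mul_I, neg_neg, one_smul, hasDerivAt_iff_tendsto_slope]
  exact hz

/-- A positive period excludes the default `timeEvolution H = 0`, for which the set of times is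
empty and its infimum is 0. A finite infimum in `absMoment` provides an energy distribution. -/
theorem exists_mem_graph_of_absMoment_lt_top [CompleteSpace E] {φ : E} (hφ : 0 < period H φ)
    (h : absMoment 3 H φ < ⊤) : ∃ y, (φ, y) ∈ H.graph := by
  have hex : ∃ U, IsTimeEvolution H U := by
    by_contra hno
    have h0 : timeEvolution H = 0 := dif_neg hno
    simp [period, h0] at hφ
  have hU : IsTimeEvolution H (timeEvolution H) := by
    rw [timeEvolution, dif_pos hex]
    exact hex.choose_spec
  simp only [absMoment, iInf_lt_iff] at h
  obtain ⟨μ, ⟨hfin, hμ⟩, hlt⟩ := h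
  exact hU.exists_mem_graph hμ (integrable_sq_of_lintegral_pow_three hlt)

end Domain

/-! ### Asymptotic continuity of the skew information at product states -/

/-- A property that holds for every tolerance at all sufficiently small scales holds for a tolerance
that vanishes with the scale. -/
theorem exists_modulus {P : ℝ → ℝ → Prop} (hmono : ∀ ε η η', η ≤ η' → P ε η → P ε η')
    (h : ∀ η > 0, ∃ ε₁ > 0, ∀ ε, 0 < ε → ε < ε₁ → P ε η) :
    ∃ δ : ℝ → ℝ, Tendsto δ (𝓝[>] 0) (𝓝 0) ∧
      ∃ ε₀ : ℝ, 0 < ε₀ ∧ ∀ ε : ℝ, 0 < ε → ε < ε₀ → P ε (δ ε) := by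
  have hbdd : ∀ ε, BddBelow {η | 0 < η ∧ P ε η} := fun ε => ⟨0, fun η hη => hη.1.le⟩
  -- The infimum need not be attained; adding `ε` gives a tolerance at which `P` holds.
  refine ⟨fun ε => sInf {η | 0 < η ∧ P ε η} + ε, ?_, ?_⟩
  · have h0 : Tendsto (fun ε => sInf {η | 0 < η ∧ P ε η}) (𝓝[>] 0) (𝓝 0) := by
      refine tendsto_order.2 ⟨fun a ha => Eventually.of_forall fun ε =>
        ha.trans_le (Real.sInf_nonneg fun η hη => hη.1.le), fun a ha => ?_⟩
      obtain ⟨ε₁, hε₁, hP⟩ := h (a / 2) (half_pos ha)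
      filter_upwards [Ioo_mem_nhdsGT hε₁] with ε hε
      exact (csInf_le (hbdd ε) ⟨half_pos ha, hP ε hε.1 hε.2⟩).trans_lt (half_lt_self ha)
    have h1 : Tendsto (fun ε : ℝ => ε) (𝓝[>] 0) (𝓝 0) := nhdsWithin_le_nhds
    simpa using h0.add h1
  · obtain ⟨ε₁, hε₁, hP⟩ := h 1 one_pos
    refine ⟨ε₁, hε₁, fun ε hε hε' => ?_⟩
    obtain ⟨η, hη, hlt⟩ := exists_lt_of_csInf_lt (s := {η | 0 < η ∧ P ε η})
      ⟨1, one_pos, hP ε hε hε'⟩ (lt_add_of_pos_right _ hε)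
    exact hmono ε η _ hlt.le hη.2

section Main

variable {K : Type*} [NormedAddCommGroup K] [InnerProductSpace ℂ K] {ι : Type*}

theorem skewInformation_iidVector_le (b : HilbertBasis ι ℂ K) {H : K →ₗ.[ℂ] K}
    (hH : H.IsFormalAdjoint H) (hd : Dense (H.domain : Set K)) {ψ y : K} (hψ : ‖ψ‖ = 1)
    (hy : (ψ, y) ∈ H.graph) {f : ℝ → ℝ} (hf0 : f 0 ≠ 0) (k : ℕ) :
    skewInformation f (pureState (iidVector b ψ k)) (iidHamiltonian b H k) ≤
      ENNReal.ofReal (k * ‖y - ⟪ψ, y⟫_ℂ • ψ‖ ^ 2) := by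
  have hΨ : ‖iidVector b ψ k‖ = 1 := norm_iidVector hψ k
  refine (skewInformation_pureState_le hf0 (iidHamiltonian_isFormalAdjoint b hH hd k) hΨ
    (iidVector_mem_graph b hH hd k ⟪ψ, y⟫_ℂ hy)).trans (ENNReal.ofReal_le_ofReal (le_of_eq ?_))
  have hψψ : ⟪ψ, ψ⟫_ℂ = 1 := by simp [inner_self_eq_norm_sq_to_K, hψ]
  have hhψ : ⟪y - ⟪ψ, y⟫_ℂ • ψ, ψ⟫_ℂ = 0 := by
    rw [inner_sub_left, inner_smul_left, inner_conj_symm, hψψ, mul_one, sub_self]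
  have h0 := inner_eq_zero_symm.1 (inner_excitation_iidVector (b := b) k hhψ)
  rw [← norm_excitation_sq (b := b) hψ k hhψ, inner_add_right, h0, inner_smul_right,
    inner_self_eq_norm_sq_to_K, hΨ]
  simp

/-- There are two losses of at most `kτ`: one from the drop of the variance, one from the weight `κ
≥ 1 - τ/(v + 1)`. -/
theorem le_skewInformation_iidHamiltonian (b : HilbertBasis ι ℂ K) {H : K →ₗ.[ℂ] K}
    (hH : H.IsFormalAdjoint H) (hd : Dense (H.domain : Set K)) {ψ y : K} (hψ : ‖ψ‖ = 1)
    (hy : (ψ, y) ∈ H.graph) {f : ℝ → ℝ} (hf : IsRegularStandardMonotone f) {τ : ℝ} (hτ : 0 < τ) :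
    ∃ ε₁ > 0, ∀ ε, 0 < ε → ε < ε₁ → ∀ (k : ℕ)
      (ρ : HilbertTensorPower ι k →L[ℂ] HilbertTensorPower ι k), IsDensityOperator ρ →
      traceDist ρ (pureState (iidVector b ψ k)) ≤ ENNReal.ofReal ε →
      ENNReal.ofReal (k * ‖y - ⟪ψ, y⟫_ℂ • ψ‖ ^ 2 - 2 * k * τ) ≤
        skewInformation f ρ (iidHamiltonian b H k) := by
  obtain ⟨s, hs, hvar⟩ := variance_iidHamiltonian_lower_bound b hH hd hψ hy hτ
  set v := ‖y - ⟪ψ, y⟫_ℂ • ψ‖ ^ 2 with hv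
  have hv0 : 0 ≤ v := sq_nonneg _
  have hθ : 1 - τ / (v + 1) < 1 := sub_lt_self _ (by positivity)
  obtain ⟨u, hu, hκ⟩ := (mem_nhdsGT_iff_exists_Ioo_subset).1
    (hf.tendsto_weight.eventually (lt_mem_nhds hθ))
  have hu0 : 0 < u := hu
  -- The lemma is applied with `d = 2ε`: this needs `2ε < u` for the weight, `2ε < 1/4`, and `2d =
  -- 4ε ≤ s` for the overlap.
  refine ⟨min (u / 2) (min (1 / 8) (s / 4)), by positivity, fun ε hε hε₁ k ρ hρ hdist => ?_⟩
  simp only [lt_min_iff] at hε₁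
  obtain ⟨hεu, hε8, hεs⟩ := hε₁
  have hκε : 1 - τ / (v + 1) < _ := hκ (⟨by linarith, by linarith⟩ : 2 * ε ∈ Set.Ioo 0 u)
  have hmain := le_skewInformation hf (iidHamiltonian_isFormalAdjoint b hH hd k) hρ
    (norm_iidVector hψ k) (d := 2 * ε) (by linarith) (by linarith)
    -- Truncation at 0 keeps the bound monotone in `κ` when `v < τ`.
    (norm_sub_le_of_traceDist_le hε.le hdist) (B := k * max (v - τ) 0)
    fun φ g hg hφ hα => by
      rw [mul_max_of_nonneg _ _ (Nat.cast_nonneg k), mul_zero]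
      exact max_le (hvar k φ g _ hg hφ (by linarith)) (sq_nonneg _)
  refine (ENNReal.ofReal_le_ofReal ?_).trans hmain
  set κ := f 0 * (1 - 4 * (2 * ε)) ^ 2 / ((1 + 2 * ε) * f (3 * (2 * ε) / (1 - 2 * ε)))
  have hκ' : 1 - τ / (v + 1) ≤ κ := hκε.le
  have hm0 : 0 ≤ max (v - τ) 0 := le_max_right _ _
  have hm1 : v - τ ≤ max (v - τ) 0 := le_max_left _ _
  have hm2 : max (v - τ) 0 ≤ v := max_le (by linarith) hv0
  have h1 : (1 - τ / (v + 1)) * max (v - τ) 0 ≤ κ * max (v - τ) 0 := by gcongr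
  have h2 : τ / (v + 1) * max (v - τ) 0 ≤ τ := by
    rw [div_mul_eq_mul_div, div_le_iff₀ (by positivity)]
    gcongr
    linarith
  have h3 : v - 2 * τ ≤ κ * max (v - τ) 0 := by linarith
  have h4 := mul_le_mul_of_nonneg_left h3 (Nat.cast_nonneg (α := ℝ) k)
  linarith

end Main

theorem lemma1 {K : Type*} [NormedAddCommGroup K] [InnerProductSpace ℂ K] [CompleteSpace K]
    {ι : Type*} (b : HilbertBasis ι ℂ K)
    (H : K →ₗ.[ℂ] K) (hH : IsSelfAdjoint H)
    (ψ : K) (hψ : ‖ψ‖ = 1) (hperiod : period H ψ = 2 * Real.pi)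
    (hmoment : absMoment 3 H ψ < ⊤)
    (f : ℝ → ℝ) (hf : IsRegularStandardMonotone f) (R : ℝ) (hR : 0 < R) :
    ∃ δ : ℝ → ℝ, Tendsto δ (𝓝[>] 0) (𝓝 0) ∧
      ∃ ε₀ : ℝ, 0 < ε₀ ∧ ∀ ε : ℝ, 0 < ε → ε < ε₀ →
        ∀ ρ : (m : ℕ) → HilbertTensorPower ι ⌈R * m⌉₊ →L[ℂ] HilbertTensorPower ι ⌈R * m⌉₊,
          (∀ m, IsDensityOperator (ρ m)) →
          (∀ᶠ m : ℕ in atTop,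
            traceDist (ρ m) (pureState (iidVector b ψ ⌈R * m⌉₊)) ≤ ENNReal.ofReal ε) →
          ∃ r : ℕ → ℝ, r =o[atTop] (fun m : ℕ => (m : ℝ)) ∧
            ∀ᶠ m : ℕ in atTop,
              ((skewInformation f (pureState (iidVector b ψ ⌈R * m⌉₊))
                  (iidHamiltonian b H ⌈R * m⌉₊) : ℝ≥0∞) : EReal)
                - ((m * δ ε : ℝ) : EReal) + ((r m : ℝ) : EReal)
              ≤ ((skewInformation f (ρ m) (iidHamiltonian b H ⌈R * m⌉₊) : ℝ≥0∞) : EReal) := by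
  have hd : Dense (H.domain : Set K) := hH.dense_domain
  have hsymm : H.IsFormalAdjoint H := by
    have h := LinearPMap.adjoint_isFormalAdjoint hd
    rwa [LinearPMap.isSelfAdjoint_def.1 hH] at h
  obtain ⟨y, hy⟩ := exists_mem_graph_of_absMoment_lt_top
    (by rw [hperiod]; positivity) hmoment
  obtain ⟨δ, hδ, ε₀, hε₀, hP⟩ := exists_modulus
    (P := fun ε η => ∀ m : ℕ, 1 ≤ m → ∀ ρ : HilbertTensorPower ι ⌈R * m⌉₊ →L[ℂ]
      HilbertTensorPower ι ⌈R * m⌉₊, IsDensityOperator ρ →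
      traceDist ρ (pureState (iidVector b ψ ⌈R * m⌉₊)) ≤ ENNReal.ofReal ε →
      ENNReal.ofReal (⌈R * m⌉₊ * ‖y - ⟪ψ, y⟫_ℂ • ψ‖ ^ 2 - m * η) ≤
        skewInformation f ρ (iidHamiltonian b H ⌈R * m⌉₊))
    (fun ε η η' hη h m hm ρ hρ hdist => le_trans (by gcongr) (h m hm ρ hρ hdist))
    fun η hη => by
      -- Since `⌈Rm⌉ ≤ (R + 1)m` for `m ≥ 1`, this `τ` turns the loss `2⌈Rm⌉τ` into at most `mη`.
      obtain ⟨ε₁, hε₁, h⟩ := le_skewInformation_iidHamiltonian b hsymm hd hψ hy hf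
        (τ := η / (2 * (R + 1))) (by positivity)
      refine ⟨ε₁, hε₁, fun ε hε hεε m hm ρ hρ hdist =>
        (ENNReal.ofReal_le_ofReal ?_).trans (h ε hε hεε _ ρ hρ hdist)⟩
      have hk : (⌈R * m⌉₊ : ℝ) ≤ (R + 1) * m := by
        have h1 := (Nat.ceil_lt_add_one (a := R * m) (by positivity)).le
        have h2 : (1 : ℝ) ≤ m := by exact_mod_cast hm
        linarith
      have h3 : 2 * (⌈R * m⌉₊ : ℝ) * (η / (2 * (R + 1))) ≤
          2 * ((R + 1) * m) * (η / (2 * (R + 1))) := by gcongr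
      have h4 : 2 * ((R + 1) * m) * (η / (2 * (R + 1))) = m * η := by field_simp
      linarith
  -- The remainder is 0: the estimate holds at each `m ≥ 1` where the distance bound does.
  refine ⟨δ, hδ, ε₀, hε₀, fun ε hε hεε ρ hρ hdist => ⟨0, Asymptotics.isLittleO_zero _ _, ?_⟩⟩
  filter_upwards [hdist, eventually_ge_atTop 1] with m hm hm1
  have hup := skewInformation_iidVector_le b hsymm hd hψ hy hf.regular ⌈R * m⌉₊
  have hlow := hP ε hε hεε m hm1 (ρ m) (hρ m) hm
  set v := (⌈R * m⌉₊ : ℝ) * ‖y - ⟪ψ, y⟫_ℂ • ψ‖ ^ 2 with hv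
  have hv0 : 0 ≤ v := by positivity
  rw [Pi.zero_apply, EReal.coe_zero, add_zero]
  calc _ ≤ ((ENNReal.ofReal v : ℝ≥0∞) : EReal) - ((m * δ ε : ℝ) : EReal) :=
        EReal.sub_le_sub (EReal.coe_ennreal_le_coe_ennreal_iff.2 hup) le_rfl
    _ = ((v - m * δ ε : ℝ) : EReal) := by
        rw [EReal.coe_ennreal_ofReal, max_eq_left hv0, EReal.coe_sub]
    _ ≤ ((ENNReal.ofReal (v - m * δ ε) : ℝ≥0∞) : EReal) := by
        rw [EReal.coe_ennreal_ofReal]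
        exact_mod_cast le_max_left _ _
    _ ≤ _ := EReal.coe_ennreal_le_coe_ennreal_iff.2 hlow
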